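/- Setting. Let $\mathcal X,\mathcal Y$ be finite alphabets and $\mathcal S\neq\emptyset$ a set of states. For each $s\in\mathcal S$, $x\in\mathcal X$ let $P_s(\cdot|x)$ be a probability distribution on $\mathcal Y$, and let $c:\mathcal X\to[0,\infty)$ be a cost function. The channel is memoryless and its state is fixed during a block and unknown to transmitter and receiver. Assume that (a) there is exactly one symbol $x_{\mathrm f}$ with $c(x_{\mathrm f})=0$, and $\mathcal X':=\mathcal X\setminus\{x_{\mathrm f}\}\neq\emptyset$; (b) the uncertainty set $\{P_s(\cdot|\cdot):s\in\mathcal S\}\subset\mathbb R^{\mathcal X\times\mathcal Y}$ is convex and compact. Codes. An $(n,M,\nu,\epsilon)$ code has block length $n$, $M\ge 1$ messages, codewords $x^{(m)}\in\mathcal X^n$ with $\sum_i c(x^{(m)}_i)\le\nu$, and a decoder whose error probability, averaged over equiprobable messages, is at most $\epsilon$ in every state $s\in\mathcal S$. For a class $\mathcal K$ of codes, $R\ge 0$ is an achievable rate per unit cost (ARPUC) of $\mathcal K$ if for every $\epsilon\in(0,1)$ and $\gamma>0$ there is $\nu_0\ge 0$ such that for every $\nu\ge\nu_0$ some $(n,M,\nu,\epsilon)$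 code in $\mathcal K$ has $\log M>\nu(R-\gamma)$. The capacity per unit cost (CPUC) $\mathbf C_{\mathrm c}\in[0,\infty]$ is the supremum of the ARPUCs of all codes. The orthogonal code (without mixing) with $x_{\mathrm c}\in\mathcal X'$, transformation $g$, $M$ messages and row length $\tilde n\ge 1$ has block length $n=M\tilde n$, read as $M$ rows of length $\tilde n$; to send message $m$, row $m$ consists of $x_{\mathrm c}$ and all other rows of $x_{\mathrm f}$. With the received symbols $Y_{m,i}$, the decoder computes $T_m=\frac1{\tilde n}\sum_{i=1}^{\tilde n}g(Y_{m,i})$ and declares the unique maximizer of $T_m$, or an error if there is a tie. Unless stated otherwise $g:\mathcal Y\to\mathbb R$ is an arbitrary real function. Claim. Write $D(P\|Q)\in[0,\infty]$ for the Kullback–Leibler divergence in nats, $P_{s,\mathrm c}:=P_s(\cdot|x_{\mathrm c})$, $P_{s,\mathrm f}:=P_s(\cdot|x_{\mathrm f})$, and $$\underline{\mathbf C}_{\mathrm c}:=\sup_{x_{\mathrm c}\in\mathcal X'}\min_{s\in\mathcal S}\frac{D(P_{s,\mathrm c}\|P_{s,\mathrm f})}{c(x_{\mathrm c})}\in[0,\infty].$$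 1. For every $x_{\mathrm c}\in\mathcal X'$ the minimum over $s$ is attained (at a *least favorable* state), and the supremum over $x_{\mathrm c}$ is attained. 2. $\underline{\mathbf C}_{\mathrm c}$ is the maximum ARPUC of orthogonal codes: a real number $R\ge 0$ is an ARPUC of the class of all orthogonal codes with real $g$ if and only if $R\le\underline{\mathbf C}_{\mathrm c}$. Moreover $\underline{\mathbf C}_{\mathrm c}$ is the supremum, over all $x_{\mathrm c}\in\mathcal X'$ and $g:\mathcal Y\to\mathbb R$, of the ARPUCs of orthogonal codes with this fixed $x_{\mathrm c}$ and $g$. 3. $\underline{\mathbf C}_{\mathrm c}\le\mathbf C_{\mathrm c}$. 4. Let $x_{\mathrm c}\in\mathcal X'$ and let $s^*$ be a least favorable state for $x_{\mathrm c}$ with $D(P_{s^*,\mathrm c}\|P_{s^*,\mathrm f})<\infty$. Assume that the log-likelihood ratio $g^*(y)=\log\frac{P_{s^*,\mathrm c}(y)}{P_{s^*,\mathrm f}(y)}\in[-\infty,\infty)$ is defined at every output that can occur, i.e. if $P_{s^*,\mathrm c}(y)=P_{s^*,\mathrm f}(y)=0$ then $P_{t,\mathrm c}(y)=P_{t,\mathrm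 f}(y)=0$ for all $t\in\mathcal S$. Then $D(P_{s^*,\mathrm c}\|P_{s^*,\mathrm f})/c(x_{\mathrm c})$ is an ARPUC of the orthogonal codes with this fixed $x_{\mathrm c}$ and with $g=g^*$ (where a row containing an output with $g^*=-\infty$ has metric $-\infty$). In particular $\underline{\mathbf C}_{\mathrm c}$ is achieved in this way when $x_{\mathrm c}$ attains the supremum. -/

import Mathlib

open scoped ENNReal BigOperators

noncomputable section

/-- A compound memoryless channel with finite output alphabet: for every state `s` and input `x`
an output distribution `P s x`, and a nonnegative cost `cost x` for every input. -/
structure CompoundChannel (X Y S : Type*) where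
  P : S → X → PMF Y
  cost : X → ℝ
  cost_nonneg : ∀ x, 0 ≤ cost x

/-- A block code: block length `n`, number of messages `M`, one codeword per message, and a decoder.
The decoder answers `none` when it declares an error. -/
structure BlockCode (X Y : Type*) where
  n : ℕ
  M : ℕ
  enc : Fin M → Fin n → X
  dec : (Fin n → Y) → Option (Fin M)

namespace CompoundChannel

variable {X Y S : Type*} [Fintype Y]

/-- The transition probability `P_s(y|x)` as a real number. -/
def W (ch : CompoundChannel X Y S) (s : S) (x : X) (y : Y) : ℝ := (ch.P s x y).toReal

open Classical in
/-- Probability of decoding error in state `s`, averaged over equiprobable messages. -/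
def errorProb (ch : CompoundChannel X Y S) (s : S) (C : BlockCode X Y) : ℝ :=
  (1 / (C.M : ℝ)) * ∑ m : Fin C.M, ∑ y : Fin C.n → Y,
    if C.dec y = some m then 0 else ∏ i, ch.W s (C.enc m i) (y i)

/-- `C` is an `(n, M, ν, ε)` code, the error bound holding in every channel state. -/
def IsCode (ch : CompoundChannel X Y S) (C : BlockCode X Y) (ν ε : ℝ) : Prop :=
  0 < C.M ∧ (∀ m, ∑ i, ch.cost (C.enc m i) ≤ ν) ∧ ∀ s, ch.errorProb s C ≤ ε

/-- `R` is an achievable rate per unit cost when only codes of the class `K` may be used. -/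
def IsARPUC (ch : CompoundChannel X Y S) (K : Set (BlockCode X Y)) (R : ℝ) : Prop :=
  0 ≤ R ∧ ∀ ε : ℝ, 0 < ε → ε < 1 → ∀ γ : ℝ, 0 < γ → ∃ ν₀ : ℝ, 0 ≤ ν₀ ∧ ∀ ν : ℝ, ν₀ ≤ ν →
    ∃ C ∈ K, ch.IsCode C ν ε ∧ ν * (R - γ) < Real.log C.M

/-- The capacity per unit cost: the supremum of the achievable rates per unit cost
of arbitrary codes (possibly infinite). -/
def cpuc (ch : CompoundChannel X Y S) : ℝ≥0∞ :=
  ⨆ (R : ℝ) (_ : ch.IsARPUC Set.univ R), ENNReal.ofReal R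

/-- The uncertainty set is convex. -/
def ConvexUncertainty (ch : CompoundChannel X Y S) : Prop :=
  ∀ s₁ s₂ : S, s₁ ≠ s₂ → ∀ α : ℝ, 0 ≤ α → α ≤ 1 →
    ∃ s : S, ∀ x y, ch.W s x y = α * ch.W s₁ x y + (1 - α) * ch.W s₂ x y

/-- The set of transition matrices is compact (in `X → Y → ℝ`). -/
def CompactUncertainty (ch : CompoundChannel X Y S) : Prop :=
  IsCompact (Set.range ch.W)

/-- The divergence `D(P_s(·|x) ‖ P_s(·|x'))` in nats, with values in `[0, ∞]`. -/
def divergence (ch : CompoundChannel X Y S) (s : S) (x x' : X) : ℝ≥0∞ :=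
  letI : MeasurableSpace Y := ⊤
  InformationTheory.klDiv (ch.P s x).toMeasure (ch.P s x').toMeasure

/-- `s` minimizes `D(P_s(·|xc) ‖ P_s(·|xf))` over all states. -/
def IsLeastFavorable (ch : CompoundChannel X Y S) (xf xc : X) (s : S) : Prop :=
  ∀ t : S, ch.divergence s xc xf ≤ ch.divergence t xc xf

/-- The log-likelihood ratio `y ↦ log (P_s(y|xc) / P_s(y|xf))`, equal to `-∞` when only the
numerator vanishes and to `+∞` when only the denominator does. -/
def logLikelihoodRatio (ch : CompoundChannel X Y S) (xf xc : X) (s : S) (y : Y) : EReal :=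
  ENNReal.log (ch.P s xc y / ch.P s xf y)

/-- `sup_{xc ≠ xf} inf_s D(P_s(·|xc) ‖ P_s(·|xf)) / c(xc)`. -/
def lowerCpuc (ch : CompoundChannel X Y S) (xf : X) : ℝ≥0∞ :=
  ⨆ (xc : X) (_ : xc ≠ xf), ⨅ s : S, ch.divergence s xc xf / ENNReal.ofReal (ch.cost xc)

end CompoundChannel

section OrthogonalCodes

variable {X Y : Type*}

/-- The decoding metric of a row: the average of `g` over its entries. -/
def rowMetric (g : Y → EReal) {k : ℕ} (row : Fin k → Y) : EReal :=
  (∑ i, g (row i)) / (k : EReal)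

open Classical in
/-- The orthogonal code with `M` messages and rows of length `k`. The block of length `M * k` is
read as `M` rows of length `k`; for message `m` the symbol `xc` is sent in row `m` and `xf` in all
other rows. The decoder answers the row of largest metric, and declares an error on a tie. -/
def orthogonalCode (xf xc : X) (g : Y → EReal) (M k : ℕ) : BlockCode X Y where
  n := M * k
  M := M
  enc m i := if (finProdFinEquiv.symm i).1 = m then xc else xf
  dec y :=
    if h : ∃ m : Fin M, ∀ m' : Fin M, m' ≠ m →
        rowMetric g (fun i : Fin k => y (finProdFinEquiv (m', i))) <
          rowMetric g (fun i : Fin k => y (finProdFinEquiv (m, i)))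
    then some h.choose else none

/-- The orthogonal codes with a fixed symbol `xc` and a fixed transformation `g`. -/
def orthogonalScheme (xf xc : X) (g : Y → EReal) : Set (BlockCode X Y) :=
  {C | ∃ M k : ℕ, 0 < k ∧ C = orthogonalCode xf xc g M k}

/-- All orthogonal codes (without mixing): any nonzero-cost symbol, any real transformation. -/
def orthogonalCodes (X Y : Type*) (xf : X) : Set (BlockCode X Y) :=
  {C | ∃ xc : X, xc ≠ xf ∧ ∃ g : Y → ℝ, C ∈ orthogonalScheme xf xc (fun y => (g y : EReal))}

end OrthogonalCodes

end

/-! Everything rests on one variational inequality, `le_klTerm`: for every test function `ρ`, D(p‖q)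
is at least ∑ (p log ρ - qρ + q), with equality at `ρ = p/q`.

Achievability. The test value is affine in the pair (p, q), so first-order optimality of a least
favorable state on each segment of the convex uncertainty set gives a saddle point (`saddle_point`):
the log-likelihood ratio `g` there satisfies E_c[g] - E_f[exp g] + 1 ≥ r in every state, where r is
the minimal divergence. This single inequality suffices for coding. The sent row falls below a
threshold just under E_c[g] with exponentially small probability, uniformly in the state; a Chernoff
bound with parameter 1 and a union bound handle the other rows as long as log M stays below about k
r (`exists_errorProb_le`, `isARPUC_orthogonalScheme`).

A least favorable ratio may be infinite or undefined at some outputs. Adding `η > 0` to all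
probabilities gives divergences that are continuous in the state and increase to the true ones as
`η` decreases to 0. Compactness then yields least favorable states and, for each rate strictly below
the bound, a real `g` (`exists_transformation`).

Converse. Testing the output law of message m against the all-`xf` law, with `ρ = M` on the decoding
region and 1 elsewhere, gives a Fano inequality (`mul_log_le_of_errorProb_le`); it is applied at a
least favorable state of the symbol used by the code. -/

noncomputable section

open Filter Topology MeasureTheory

/-! ### Relative entropy terms: variational bound and smoothing -/

/-- The pointwise contribution `p log (p / q) - p + q` to a relative entropy. -/
def klTerm (p q : ℝ) : ℝ := p * Real.log (p / q) - p + q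

/-- This is log x ≤ x - 1 at `x = qρ/p`, multiplied by `p`. It serves the saddle point, the
monotonicity of smoothing and the converse alike. -/
lemma le_klTerm {p q ρ : ℝ} (hp : 0 ≤ p) (hq : 0 ≤ q) (hρ : 0 ≤ ρ) (h : q = 0 → p = 0)
    (h' : ρ = 0 → p = 0) : p * Real.log ρ - q * ρ + q ≤ klTerm p q := by
  unfold klTerm
  rcases hp.eq_or_lt with rfl | hp
  · have := mul_nonneg hq hρ
    simp
    linarith
  · have hq : 0 < q := hq.lt_of_ne fun e => hp.ne' (h e.symm)
    have hρ : 0 < ρ := hρ.lt_of_ne fun e => hp.ne' (h' e.symm)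
    have h1 := Real.log_le_sub_one_of_pos (x := q * ρ / p) (by positivity)
    rw [Real.log_div (by positivity) hp.ne', Real.log_mul hq.ne' hρ.ne'] at h1
    rw [Real.log_div hp.ne' hq.ne']
    have h2 := mul_le_mul_of_nonneg_left h1 hp.le
    have h3 : p * (q * ρ / p - 1) = q * ρ - p := by field_simp
    rw [h3] at h2
    nlinarith

lemma klTerm_nonneg {p q : ℝ} (hp : 0 ≤ p) (hq : 0 ≤ q) (h : q = 0 → p = 0) :
    0 ≤ klTerm p q := by
  have := le_klTerm hp hq zero_le_one h (by simp)
  simpa using this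

lemma klTerm_eq {p q : ℝ} (h : q = 0 → p = 0) :
    klTerm p q = p * Real.log (p / q) - q * (p / q) + q := by
  unfold klTerm
  by_cases hq : q = 0
  · simp [hq, h hq]
  · rw [mul_div_cancel₀ _ hq]

lemma klTerm_eq_mul_klFun {p q : ℝ} (h : q = 0 → p = 0) :
    klTerm p q = q * InformationTheory.klFun (p / q) := by
  unfold klTerm InformationTheory.klFun
  by_cases hq : q = 0
  · simp [hq, h hq]
  · field_simp
    ring

/-- Test (p, q) with the smoothed ratio `ρ`: the two sides then differ by η(log ρ - ρ + 1), which is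
at most 0. -/
lemma klTerm_add_le {p q η : ℝ} (hp : 0 ≤ p) (hq : 0 ≤ q) (h : q = 0 → p = 0) (hη : 0 < η) :
    klTerm (p + η) (q + η) ≤ klTerm p q := by
  have hp' : 0 < p + η := by linarith
  have hq' : 0 < q + η := by linarith
  rw [klTerm_eq (p := p + η) (by intro h; linarith)]
  have hρ : 0 < (p + η) / (q + η) := by positivity
  have h1 := le_klTerm hp hq hρ.le h (fun e => absurd e hρ.ne')
  have h2 := mul_le_mul_of_nonneg_left (Real.log_le_sub_one_of_pos hρ) hη.le
  nlinarith

lemma klTerm_add_anti {p q η η' : ℝ} (hp : 0 ≤ p) (hq : 0 ≤ q) (hη : 0 < η) (h : η ≤ η') :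
    klTerm (p + η') (q + η') ≤ klTerm (p + η) (q + η) := by
  rcases h.eq_or_lt with rfl | h
  · exact le_rfl
  · have := klTerm_add_le (p := p + η) (q := q + η) (η := η' - η) (by linarith) (by linarith)
      (by intro; linarith) (by linarith)
    simpa [add_assoc] using this

lemma tendsto_klTerm_add {p q : ℝ} (hp : 0 ≤ p) (hq : 0 ≤ q) (h : q = 0 → p = 0) :
    Tendsto (fun η => klTerm (p + η) (q + η)) (𝓝[>] 0) (𝓝 (klTerm p q)) := by
  by_cases hq0 : q = 0
  · have hp0 := h hq0
    subst hq0 hp0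
    refine tendsto_const_nhds.congr' ?_
    filter_upwards [self_mem_nhdsWithin] with η (hη : 0 < η)
    simp [klTerm, div_self hη.ne']
  · have hc : Tendsto (fun η : ℝ => (q + η) * InformationTheory.klFun ((p + η) / (q + η)))
        (𝓝 0) (𝓝 ((q + 0) * InformationTheory.klFun ((p + 0) / (q + 0)))) := by
      apply ContinuousAt.tendsto
      have : ContinuousAt (fun η : ℝ => (p + η) / (q + η)) 0 :=
        ContinuousAt.div (by fun_prop) (by fun_prop) (by simpa using hq0)
      exact ContinuousAt.mul (by fun_prop)
        (InformationTheory.continuous_klFun.continuousAt.comp this)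
    rw [add_zero, add_zero, ← klTerm_eq_mul_klFun h] at hc
    refine (hc.mono_left nhdsWithin_le_nhds).congr' ?_
    filter_upwards [self_mem_nhdsWithin] with η (hη : 0 < η)
    rw [klTerm_eq_mul_klFun]
    intro; linarith

lemma tendsto_klTerm_add_atTop {p : ℝ} (hp : 0 < p) :
    Tendsto (fun η => klTerm (p + η) (0 + η)) (𝓝[>] 0) atTop := by
  have h1 : Tendsto (fun η : ℝ => p * (Real.log p - Real.log η) - p) (𝓝[>] 0) atTop := by
    apply tendsto_atTop_add_const_right
    apply Tendsto.const_mul_atTop hp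
    simp only [sub_eq_add_neg]
    apply tendsto_atTop_add_const_left
    exact tendsto_neg_atBot_atTop.comp (Real.tendsto_log_nhdsGT_zero)
  refine tendsto_atTop_mono' _ ?_ h1
  filter_upwards [self_mem_nhdsWithin] with η (hη : 0 < η)
  have h := le_klTerm (p := p + η) (q := η) (ρ := p / η) (by linarith) hη.le (by positivity)
    (by intro; linarith) (fun e => absurd e (by positivity))
  rw [mul_div_cancel₀ _ hη.ne', Real.log_div hp.ne' hη.ne'] at h
  rw [zero_add]
  by_cases hc : η ≤ p
  · have : 0 ≤ η * (Real.log p - Real.log η) :=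
      mul_nonneg hη.le (sub_nonneg.2 (Real.log_le_log hη hc))
    nlinarith
  · have : p * (Real.log p - Real.log η) ≤ 0 :=
      mul_nonpos_of_nonneg_of_nonpos hp.le
        (sub_nonpos.2 (Real.log_le_log hp (not_le.1 hc).le))
    have := klTerm_nonneg (p := p + η) (q := η) (by linarith) hη.le (by intro; linarith)
    linarith

/-! ### Divergence of the channel and its continuous approximation from below -/

namespace CompoundChannel

variable {X Y S : Type*}

lemma W_nonneg (ch : CompoundChannel X Y S) (s : S) (x : X) (y : Y) : 0 ≤ ch.W s x y :=
  ENNReal.toReal_nonneg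

lemma ofReal_W (ch : CompoundChannel X Y S) (s : S) (x : X) (y : Y) :
    ENNReal.ofReal (ch.W s x y) = ch.P s x y :=
  ENNReal.ofReal_toReal (PMF.apply_ne_top _ _)

lemma W_eq_zero_iff (ch : CompoundChannel X Y S) (s : S) (x : X) (y : Y) :
    ch.W s x y = 0 ↔ ch.P s x y = 0 := by
  simp [W, ENNReal.toReal_eq_zero_iff, PMF.apply_ne_top]

variable [Fintype Y]

lemma sum_W (ch : CompoundChannel X Y S) (s : S) (x : X) : ∑ y, ch.W s x y = 1 := by
  unfold W
  rw [← ENNReal.toReal_sum fun y _ => PMF.apply_ne_top _ _,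
    ← tsum_fintype (L := .unconditional _), PMF.tsum_coe]
  rfl

/-- The sum of `klTerm` over the outputs, after adding `η` to all probabilities. -/
def smoothedDivergence (ch : CompoundChannel X Y S) (xf xc : X) (η : ℝ) (s : S) : ℝ :=
  ∑ y, klTerm (ch.W s xc y + η) (ch.W s xf y + η)

lemma divergence_eq_top (ch : CompoundChannel X Y S) (s : S) (x x' : X) (y : Y)
    (h : ch.W s x y ≠ 0) (h' : ch.W s x' y = 0) : ch.divergence s x x' = ⊤ := by
  let _ : MeasurableSpace Y := ⊤
  refine InformationTheory.klDiv_of_not_ac fun hac => h ?_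
  have h1 : (ch.P s x').toMeasure {y} = 0 := by
    rw [PMF.toMeasure_apply_singleton _ _ (MeasurableSet.singleton y), ← W_eq_zero_iff, h']
  have h2 := hac h1
  rwa [PMF.toMeasure_apply_singleton _ _ (MeasurableSet.singleton y), ← W_eq_zero_iff] at h2

lemma divergence_eq_ofReal_sum (ch : CompoundChannel X Y S) (s : S) (x x' : X)
    (h : ∀ y, ch.W s x' y = 0 → ch.W s x y = 0) :
    ch.divergence s x x' = ENNReal.ofReal (∑ y, klTerm (ch.W s x y) (ch.W s x' y)) := by
  let _ : MeasurableSpace Y := ⊤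
  have hac : (ch.P s x).toMeasure ≪ (ch.P s x').toMeasure := by
    refine Measure.AbsolutelyContinuous.mk fun A hA h0 => ?_
    rw [PMF.toMeasure_apply_eq_zero_iff _ hA] at h0 ⊢
    refine h0.mono_left fun y hy => ?_
    rw [PMF.mem_support_iff, ne_eq, ← W_eq_zero_iff] at hy ⊢
    exact fun e => hy (h y e)
  unfold divergence
  rw [InformationTheory.klDiv_eq_lintegral_klFun_of_ac hac, lintegral_fintype,
    ENNReal.ofReal_sum_of_nonneg fun y _ => klTerm_nonneg (ch.W_nonneg s x y)
      (ch.W_nonneg s x' y) (h y)]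
  refine Finset.sum_congr rfl fun y _ => ?_
  have hr : ((ch.P s x).toMeasure.rnDeriv (ch.P s x').toMeasure y) * ch.P s x' y = ch.P s x y := by
    have h1 := congrArg (fun μ : Measure Y => μ {y}) (Measure.withDensity_rnDeriv_eq _ _ hac)
    beta_reduce at h1
    rw [withDensity_apply _ (MeasurableSet.singleton y),
      lintegral_singleton,
      PMF.toMeasure_apply_singleton _ _ (MeasurableSet.singleton y),
      PMF.toMeasure_apply_singleton _ _ (MeasurableSet.singleton y)] at h1
    exact h1
  rw [PMF.toMeasure_apply_singleton _ _ (MeasurableSet.singleton y), ← ofReal_W,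
    klTerm_eq_mul_klFun (h y), mul_comm, ENNReal.ofReal_mul (ch.W_nonneg s x' y)]
  by_cases h0 : ch.W s x' y = 0
  · simp [h0]
  · congr 4
    have h2 := congrArg ENNReal.toReal hr
    rw [ENNReal.toReal_mul] at h2
    rw [eq_div_iff h0]
    exact h2

lemma absolutelyContinuous_of_divergence_ne_top (ch : CompoundChannel X Y S) {s : S} {x x' : X}
    (h : ch.divergence s x x' ≠ ⊤) (y : Y) (hy : ch.W s x' y = 0) : ch.W s x y = 0 := by
  by_contra h0
  exact h (ch.divergence_eq_top s x x' y h0 hy)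

lemma smoothedDivergence_le (ch : CompoundChannel X Y S) (xf xc : X) (s : S) {η : ℝ}
    (hη : 0 < η) : ENNReal.ofReal (ch.smoothedDivergence xf xc η s) ≤ ch.divergence s xc xf := by
  by_cases h : ch.divergence s xc xf = ⊤
  · simp [h]
  · have h := ch.absolutelyContinuous_of_divergence_ne_top h
    rw [ch.divergence_eq_ofReal_sum s xc xf h]
    exact ENNReal.ofReal_le_ofReal (Finset.sum_le_sum fun y _ =>
      klTerm_add_le (ch.W_nonneg _ _ _) (ch.W_nonneg _ _ _) (h y) hη)

lemma smoothedDivergence_anti (ch : CompoundChannel X Y S) (xf xc : X) (s : S) {η η' : ℝ}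
    (hη : 0 < η) (h : η ≤ η') :
    ch.smoothedDivergence xf xc η' s ≤ ch.smoothedDivergence xf xc η s :=
  Finset.sum_le_sum fun _ _ => klTerm_add_anti (ch.W_nonneg _ _ _) (ch.W_nonneg _ _ _) hη h

/-- Smoothed divergences approach the true one as `η` tends to 0, including the value ∞: there a
single output with vanishing denominator makes its term diverge while all other terms stay
nonnegative. -/
lemma exists_lt_smoothedDivergence (ch : CompoundChannel X Y S) (xf xc : X) (s : S) {r : ℝ}
    (hr0 : 0 ≤ r) (hr : ENNReal.ofReal r < ch.divergence s xc xf) :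
    ∃ η : ℝ, 0 < η ∧ r < ch.smoothedDivergence xf xc η s := by
  suffices h : ∀ᶠ η in 𝓝[>] (0 : ℝ), r < ch.smoothedDivergence xf xc η s by
    obtain ⟨η, h1, h2⟩ := (h.and self_mem_nhdsWithin).exists
    exact ⟨η, h2, h1⟩
  by_cases h : ∀ y, ch.W s xf y = 0 → ch.W s xc y = 0
  · rw [ch.divergence_eq_ofReal_sum s xc xf h, ENNReal.ofReal_lt_ofReal_iff_of_nonneg hr0] at hr
    have := tendsto_finsetSum Finset.univ fun y (_ : y ∈ Finset.univ) =>
      tendsto_klTerm_add (ch.W_nonneg s xc y) (ch.W_nonneg s xf y) (h y)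
    exact this.eventually_const_lt hr
  · push Not at h
    obtain ⟨y, hf, hc⟩ := h
    have hc : 0 < ch.W s xc y := (ch.W_nonneg _ _ _).lt_of_ne hc.symm
    filter_upwards [(tendsto_klTerm_add_atTop hc).eventually_gt_atTop r, self_mem_nhdsWithin]
      with η h1 (hη : 0 < η)
    rw [← hf] at h1
    refine h1.trans_le (Finset.single_le_sum
      (f := fun y => klTerm (ch.W s xc y + η) (ch.W s xf y + η)) (fun z _ => ?_)
      (Finset.mem_univ y))
    have h2 := ch.W_nonneg s xc z
    have h3 := ch.W_nonneg s xf z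
    exact klTerm_nonneg (by linarith) (by linarith) (by intro; linarith)

lemma continuous_smoothedDivergence [TopologicalSpace S] (ch : CompoundChannel X Y S)
    (hW : Continuous ch.W) (xf xc : X) {η : ℝ} (hη : 0 < η) :
    Continuous (ch.smoothedDivergence xf xc η) := by
  have hw : ∀ x y, Continuous fun s => ch.W s x y := fun x y =>
    (continuous_apply y).comp ((continuous_apply x).comp hW)
  have hpos : ∀ s x y, 0 < ch.W s x y + η := fun s x y => by
    have := ch.W_nonneg s x y
    linarith
  refine continuous_finsetSum _ fun y _ => ?_
  unfold klTerm
  have h1 : ∀ x, Continuous fun s => ch.W s x y + η := fun x => (hw x y).add continuous_const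
  refine (((h1 xc).mul (Continuous.log ((h1 xc).div (h1 xf) fun s => (hpos _ _ _).ne') ?_)).sub
    (h1 xc)).add (h1 xf)
  exact fun s => (div_pos (hpos _ _ _) (hpos _ _ _)).ne'

end CompoundChannel

/-! ### Saddle point from minimality along segments -/

section Saddle

variable {ι : Type*} [Fintype ι] {a₀ b₀ a₁ b₁ : ι → ℝ}

/-- If `(a₀, b₀)` minimizes the divergence on the segment to `(a₁, b₁)`, then the likelihood ratio
at an intermediate point gives a variational lower bound for `(a₁, b₁)`. -/
lemma klTerm_sum_le_of_segment {α : ℝ} (hα : 0 < α) (hα1 : α < 1)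
    (ha₀ : ∀ i, 0 ≤ a₀ i) (hb₀ : ∀ i, 0 ≤ b₀ i) (ha₁ : ∀ i, 0 ≤ a₁ i) (hb₁ : ∀ i, 0 ≤ b₁ i)
    (h0 : ∀ i, b₀ i = 0 → a₀ i = 0 ∧ a₁ i = 0 ∧ b₁ i = 0)
    (hmin : ∑ i, klTerm (a₀ i) (b₀ i) ≤
      ∑ i, klTerm (α * a₁ i + (1 - α) * a₀ i) (α * b₁ i + (1 - α) * b₀ i)) :
    ∑ i, klTerm (a₀ i) (b₀ i) ≤
      ∑ i, (a₁ i * Real.log ((α * a₁ i + (1 - α) * a₀ i) / (α * b₁ i + (1 - α) * b₀ i)) -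
        b₁ i * ((α * a₁ i + (1 - α) * a₀ i) / (α * b₁ i + (1 - α) * b₀ i)) + b₁ i) := by
  have hβ : 0 < 1 - α := by linarith
  have hp : ∀ i, 0 ≤ α * a₁ i + (1 - α) * a₀ i := fun i =>
    add_nonneg (mul_nonneg hα.le (ha₁ i)) (mul_nonneg hβ.le (ha₀ i))
  have hq : ∀ i, 0 ≤ α * b₁ i + (1 - α) * b₀ i := fun i =>
    add_nonneg (mul_nonneg hα.le (hb₁ i)) (mul_nonneg hβ.le (hb₀ i))
  have hp0 : ∀ i, α * a₁ i + (1 - α) * a₀ i = 0 → a₀ i = 0 := fun i h => by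
    have := mul_nonneg hα.le (ha₁ i)
    have := mul_nonneg hβ.le (ha₀ i)
    have : (1 - α) * a₀ i = 0 := by linarith
    simpa [hβ.ne'] using this
  have hq0 : ∀ i, α * b₁ i + (1 - α) * b₀ i = 0 → b₀ i = 0 := fun i h => by
    have := mul_nonneg hα.le (hb₁ i)
    have := mul_nonneg hβ.le (hb₀ i)
    have : (1 - α) * b₀ i = 0 := by linarith
    simpa [hβ.ne'] using this
  set ρ : ι → ℝ := fun i => (α * a₁ i + (1 - α) * a₀ i) / (α * b₁ i + (1 - α) * b₀ i) with hρ
  have hF : ∑ i, (a₀ i * Real.log (ρ i) - b₀ i * ρ i + b₀ i) ≤ ∑ i, klTerm (a₀ i) (b₀ i) := by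
    refine Finset.sum_le_sum fun i _ => le_klTerm (ha₀ i) (hb₀ i) (div_nonneg (hp i) (hq i))
      (fun h => (h0 i h).1) fun h => ?_
    rcases div_eq_zero_iff.1 h with h | h
    · exact hp0 i h
    · exact (h0 i (hq0 i h)).1
  -- The test value is affine in the pair and tight at the mixture that defines `ρ`. As the value at
  -- `(a₀, b₀)` is at most the minimum and the average is at least the minimum, the value at `(a₁,
  -- b₁)` is at least the minimum.
  have hD : ∑ i, klTerm (α * a₁ i + (1 - α) * a₀ i) (α * b₁ i + (1 - α) * b₀ i) =
      α * ∑ i, (a₁ i * Real.log (ρ i) - b₁ i * ρ i + b₁ i) +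
        (1 - α) * ∑ i, (a₀ i * Real.log (ρ i) - b₀ i * ρ i + b₀ i) := by
    rw [Finset.mul_sum, Finset.mul_sum, ← Finset.sum_add_distrib]
    refine Finset.sum_congr rfl fun i _ => ?_
    rw [klTerm_eq fun h => by
      obtain ⟨h1, h2, -⟩ := h0 i (hq0 i h)
      simp [h1, h2]]
    simp only [hρ]
    ring
  have h1 := mul_le_mul_of_nonneg_left hF hβ.le
  have h2 : α * ∑ i, klTerm (a₀ i) (b₀ i) ≤
      α * ∑ i, (a₁ i * Real.log (ρ i) - b₁ i * ρ i + b₁ i) := by linarith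
  exact le_of_mul_le_mul_left h2 hα

/-- First order optimality: the likelihood ratio at a minimizer `(a₀, b₀)` of the divergence
attains at least the minimum against every `(a₁, b₁)` on whose segment `(a₀, b₀)` is minimal. -/
lemma saddle_point (ha₀ : ∀ i, 0 ≤ a₀ i) (hb₀ : ∀ i, 0 ≤ b₀ i) (ha₁ : ∀ i, 0 ≤ a₁ i)
    (hb₁ : ∀ i, 0 ≤ b₁ i) (h0 : ∀ i, b₀ i = 0 → a₀ i = 0 ∧ a₁ i = 0 ∧ b₁ i = 0)
    (hmin : ∀ α : ℝ, 0 < α → α < 1 → ∑ i, klTerm (a₀ i) (b₀ i) ≤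
      ∑ i, klTerm (α * a₁ i + (1 - α) * a₀ i) (α * b₁ i + (1 - α) * b₀ i)) :
    (∀ i, a₀ i = 0 → a₁ i = 0) ∧
    ∑ i, klTerm (a₀ i) (b₀ i) ≤
      ∑ i, (a₁ i * Real.log (a₀ i / b₀ i) - b₁ i * (a₀ i / b₀ i) + b₁ i) := by
  set r : ℝ → ι → ℝ := fun α i => (α * a₁ i + (1 - α) * a₀ i) / (α * b₁ i + (1 - α) * b₀ i)
    with hr
  set F : ℝ → ι → ℝ := fun α i => a₁ i * Real.log (r α i) - b₁ i * r α i + b₁ i with hF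
  have hle : ∀ᶠ α in 𝓝[>] (0 : ℝ), ∑ i, klTerm (a₀ i) (b₀ i) ≤ ∑ i, F α i := by
    filter_upwards [Ioo_mem_nhdsGT (zero_lt_one (α := ℝ))] with α hα
    exact klTerm_sum_le_of_segment hα.1 hα.2 ha₀ hb₀ ha₁ hb₁ h0 (hmin α hα.1 hα.2)
  have hrlim : ∀ i, b₀ i ≠ 0 → Tendsto (fun α => r α i) (𝓝[>] 0) (𝓝 (a₀ i / b₀ i)) := by
    intro i hi
    have : ContinuousAt (fun α => r α i) 0 :=
      ContinuousAt.div (by fun_prop) (by fun_prop) (by simpa using hi)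
    have := this.tendsto.mono_left (nhdsWithin_le_nhds (s := Set.Ioi 0))
    simpa [hr] using this
  have hlim : ∀ i, (a₀ i = 0 → a₁ i = 0) → Tendsto (fun α => F α i) (𝓝[>] 0)
      (𝓝 (a₁ i * Real.log (a₀ i / b₀ i) - b₁ i * (a₀ i / b₀ i) + b₁ i)) := by
    intro i hi
    by_cases hb : b₀ i = 0
    · obtain ⟨-, h1, h2⟩ := h0 i hb
      simp [hF, h1, h2]
    · refine Tendsto.add_const _ (Tendsto.sub ?_ ((hrlim i hb).const_mul _))
      by_cases ha : a₀ i = 0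
      · simp [hi ha]
      · exact ((hrlim i hb).log (div_ne_zero ha hb)).const_mul _
  have hbot : ∀ i, a₀ i = 0 → a₁ i ≠ 0 → Tendsto (fun α => F α i) (𝓝[>] 0) atBot := by
    intro i hi hi1
    have hb : b₀ i ≠ 0 := fun h => hi1 (h0 i h).2.1
    have hbpos : 0 < b₀ i := (hb₀ i).lt_of_ne hb.symm
    have hapos : 0 < a₁ i := (ha₁ i).lt_of_ne hi1.symm
    have hl := hrlim i hb
    refine Tendsto.atBot_add (C := b₁ i) ?_ tendsto_const_nhds
    simp only [sub_eq_add_neg]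
    refine Tendsto.atBot_add ?_ ((hl.const_mul (b₁ i)).neg)
    refine Tendsto.const_mul_atBot hapos ?_
    refine Real.tendsto_log_nhdsGT_zero.comp (tendsto_nhdsWithin_iff.2 ⟨?_, ?_⟩)
    · simpa [hi] using hl
    · filter_upwards [Ioo_mem_nhdsGT (zero_lt_one (α := ℝ))] with α hα
      have h1 : 0 < α * a₁ i + (1 - α) * a₀ i := by
        rw [hi]
        have := mul_pos hα.1 hapos
        linarith
      have h2 : 0 < α * b₁ i + (1 - α) * b₀ i :=
        add_pos_of_nonneg_of_pos (mul_nonneg hα.1.le (hb₁ i))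
          (mul_pos (by linarith [hα.2]) hbpos)
      exact div_pos h1 h2
  -- If `a₁` charged a zero of `a₀`, that term would tend to -∞ as `α` tends to 0 while the others
  -- stay bounded above, contradicting the lower bound `hle`.
  have hac : ∀ i, a₀ i = 0 → a₁ i = 0 := by
    by_contra hcon
    push Not at hcon
    obtain ⟨j, hj, hj1⟩ := hcon
    have hbdd : ∀ i, ∃ C : ℝ, ∀ᶠ α in 𝓝[>] (0 : ℝ), F α i ≤ C := by
      intro i
      by_cases hi : a₀ i = 0 → a₁ i = 0
      · exact ⟨_, (hlim i hi).eventually_le_const (lt_add_one _)⟩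
      · push Not at hi
        exact ⟨0, (hbot i hi.1 hi.2).eventually_le_atBot 0⟩
    classical
    choose C hC using hbdd
    have hjb := (hbot j hj hj1).eventually_le_atBot
      (∑ i, klTerm (a₀ i) (b₀ i) - ∑ i ∈ Finset.univ.erase j, C i - 1)
    obtain ⟨α, h1, h2, h3⟩ := (hle.and (hjb.and (eventually_all.2 hC))).exists
    rw [← Finset.add_sum_erase _ (fun i => F α i) (Finset.mem_univ j)] at h1
    have h4 : ∑ i ∈ Finset.univ.erase j, F α i ≤ ∑ i ∈ Finset.univ.erase j, C i :=
      Finset.sum_le_sum fun i _ => h3 i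
    linarith
  refine ⟨hac, ?_⟩
  exact le_of_tendsto_of_tendsto tendsto_const_nhds
    (tendsto_finsetSum _ fun i _ => hlim i (hac i)) hle

end Saddle

/-! ### Least favorable states and the minimax transformation -/

namespace CompoundChannel

variable {X Y S : Type*}

lemma IsLeastFavorable.iInf_eq {ch : CompoundChannel X Y S} {xf xc : X} {s : S}
    (hs : ch.IsLeastFavorable xf xc s) :
    ⨅ t : S, ch.divergence t xc xf / ENNReal.ofReal (ch.cost xc) =
      ch.divergence s xc xf / ENNReal.ofReal (ch.cost xc) :=
  le_antisymm (iInf_le _ s) (le_iInf fun t => ENNReal.div_le_div_right (hs t) _)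

lemma IsLeastFavorable.le_lowerCpuc {ch : CompoundChannel X Y S} {xf xc : X} {s : S}
    (hs : ch.IsLeastFavorable xf xc s) (hxc : xc ≠ xf) :
    ch.divergence s xc xf / ENNReal.ofReal (ch.cost xc) ≤ ch.lowerCpuc xf := by
  rw [← hs.iInf_eq]
  exact le_iSup₂ (f := fun (xc : X) (_ : xc ≠ xf) =>
    ⨅ s : S, ch.divergence s xc xf / ENNReal.ofReal (ch.cost xc)) xc hxc

lemma exists_segment (ch : CompoundChannel X Y S) (hconv : ch.ConvexUncertainty) (s t : S)
    {α : ℝ} (h0 : 0 ≤ α) (h1 : α ≤ 1) :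
    ∃ u, ∀ x y, ch.W u x y = α * ch.W t x y + (1 - α) * ch.W s x y := by
  by_cases h : t = s
  · exact ⟨s, fun x y => by rw [h]; ring⟩
  · exact hconv t s h α h0 h1

variable [Fintype Y]

/-- The divergence is a limit from below of continuous functions, hence lower semicontinuous, and so
attains its minimum on a compact space. -/
lemma exists_isLeastFavorable [Nonempty S] (ch : CompoundChannel X Y S)
    (hcomp : ch.CompactUncertainty) (xf xc : X) : ∃ s : S, ch.IsLeastFavorable xf xc s := by
  -- The pulled-back topology need not be Hausdorff, but it makes `S` compact and the transition
  -- matrix continuous.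
  let _ : TopologicalSpace S := .induced ch.W inferInstance
  have hind : Topology.IsInducing ch.W := ⟨rfl⟩
  have hK : IsCompact (Set.univ : Set S) := by
    rw [hind.isCompact_iff, Set.image_univ]
    exact hcomp
  have hlsc : LowerSemicontinuous fun s => ch.divergence s xc xf := by
    intro s r hr
    have hr' : ENNReal.ofReal r.toReal = r := ENNReal.ofReal_toReal (ne_top_of_lt hr)
    obtain ⟨η, hη, h⟩ := ch.exists_lt_smoothedDivergence xf xc s ENNReal.toReal_nonneg
      (hr'.symm ▸ hr)
    filter_upwards [(ch.continuous_smoothedDivergence hind.continuous xf xc hη).continuousAt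
      |>.eventually_const_lt h] with t ht
    refine lt_of_lt_of_le ?_ (ch.smoothedDivergence_le xf xc t hη)
    rw [← hr', ENNReal.ofReal_lt_ofReal_iff_of_nonneg ENNReal.toReal_nonneg]
    exact ht
  obtain ⟨s, -, hs⟩ := (hlsc.lowerSemicontinuousOn _).exists_isMinOn Set.univ_nonempty hK
  exact ⟨s, fun t => hs (Set.mem_univ t)⟩

/-- A minimax property: below the least divergence there is a real transformation which is
simultaneously good for all states. -/
lemma exists_transformation [Nonempty S] (ch : CompoundChannel X Y S)
    (hconv : ch.ConvexUncertainty) (hcomp : ch.CompactUncertainty) (xf xc : X) {r : ℝ}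
    (hr0 : 0 ≤ r) (hr : ∀ s, ENNReal.ofReal r < ch.divergence s xc xf) :
    ∃ g : Y → ℝ, ∀ t, r ≤ ∑ y, (ch.W t xc y * g y - ch.W t xf y * Real.exp (g y)) + 1 := by
  let _ : TopologicalSpace S := .induced ch.W inferInstance
  have hind : Topology.IsInducing ch.W := ⟨rfl⟩
  have hK : IsCompact (Set.univ : Set S) := by
    rw [hind.isCompact_iff, Set.image_univ]
    exact hcomp
  -- A Dini argument: each state has its own `η`, a finite subcover leaves finitely many, and the
  -- smallest works everywhere by monotonicity.
  obtain ⟨η, hη, hηr⟩ : ∃ η : ℝ, 0 < η ∧ ∀ s, r < ch.smoothedDivergence xf xc η s := by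
    choose η hη hlt using fun s => ch.exists_lt_smoothedDivergence xf xc s hr0 (hr s)
    obtain ⟨T, -, hT⟩ := hK.elim_nhds_subcover
      (fun s => {t | r < ch.smoothedDivergence xf xc (η s) t}) fun s _ =>
        (ch.continuous_smoothedDivergence hind.continuous xf xc (hη s)).continuousAt
          |>.eventually_const_lt (hlt s)
    have hTne : T.Nonempty := by
      obtain ⟨s⟩ := ‹Nonempty S›
      obtain ⟨t, ht, -⟩ := Set.mem_iUnion₂.1 (hT (Set.mem_univ s))
      exact ⟨t, ht⟩
    obtain ⟨u, hu, hmin⟩ := T.exists_min_image η hTne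
    refine ⟨η u, hη u, fun s => ?_⟩
    obtain ⟨t, ht, hlt'⟩ := Set.mem_iUnion₂.1 (hT (Set.mem_univ s))
    exact lt_of_lt_of_le hlt' (ch.smoothedDivergence_anti xf xc s (hη u) (hmin t ht))
  obtain ⟨s, -, hs⟩ := hK.exists_isMinOn Set.univ_nonempty
    (ch.continuous_smoothedDivergence hind.continuous xf xc hη).continuousOn
  have hpos : ∀ s x y, 0 < ch.W s x y + η := fun s x y => by
    have := ch.W_nonneg s x y
    linarith
  -- All smoothed probabilities are positive, so this ratio has a real logarithm even when the true
  -- divergence is infinite.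
  refine ⟨fun y => Real.log ((ch.W s xc y + η) / (ch.W s xf y + η)), fun t => ?_⟩
  have key := (saddle_point (a₀ := fun y => ch.W s xc y + η) (b₀ := fun y => ch.W s xf y + η)
    (a₁ := fun y => ch.W t xc y + η) (b₁ := fun y => ch.W t xf y + η)
    (fun y => (hpos _ _ _).le) (fun y => (hpos _ _ _).le) (fun y => (hpos _ _ _).le)
    (fun y => (hpos _ _ _).le) (fun y h => absurd h (hpos _ _ _).ne') fun α hα hα1 => by
      obtain ⟨u, hu⟩ := ch.exists_segment hconv s t hα.le hα1.le
      refine (hs (Set.mem_univ u)).trans_eq (Finset.sum_congr rfl fun y _ => ?_)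
      rw [hu, hu]
      congr 1 <;> ring).2
  refine (hηr s).le.trans (key.trans ?_)
  rw [← ch.sum_W t xf, ← Finset.sum_add_distrib]
  refine Finset.sum_le_sum fun y _ => ?_
  have hρ := div_pos (hpos s xc y) (hpos s xf y)
  rw [Real.exp_log hρ]
  -- The terms left over from smoothing sum to η(log ρ - ρ + 1) ≤ 0 at each output and may be
  -- dropped.
  have := mul_le_mul_of_nonneg_left (Real.log_le_sub_one_of_pos hρ) hη.le
  nlinarith

/-- The log-likelihood ratio at a least favorable state satisfies the minimax inequality in every
state, and no state gives positive probability to an output where the numerator vanishes. -/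
lemma IsLeastFavorable.saddle_point {ch : CompoundChannel X Y S}
    (hconv : ch.ConvexUncertainty) {xf xc : X} {s : S} (hs : ch.IsLeastFavorable xf xc s)
    (hfin : ch.divergence s xc xf ≠ ⊤)
    (hdef : ∀ y : Y, ch.W s xc y = 0 → ch.W s xf y = 0 →
      ∀ t : S, ch.W t xc y = 0 ∧ ch.W t xf y = 0) (t : S) :
    (∀ y, ch.W s xc y = 0 → ch.W t xc y = 0) ∧
    (ch.divergence s xc xf).toReal ≤
      ∑ y, (ch.W t xc y * Real.log (ch.W s xc y / ch.W s xf y) -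
        ch.W t xf y * (ch.W s xc y / ch.W s xf y)) + 1 := by
  have hac := ch.absolutelyContinuous_of_divergence_ne_top hfin
  have hz : ∀ y, ch.W s xf y = 0 → ∀ t, ch.W t xc y = 0 ∧ ch.W t xf y = 0 := fun y hy =>
    hdef y (hac y hy) hy
  have hnn : 0 ≤ ∑ y, klTerm (ch.W s xc y) (ch.W s xf y) := Finset.sum_nonneg fun y _ =>
    klTerm_nonneg (ch.W_nonneg _ _ _) (ch.W_nonneg _ _ _) (hac y)
  have key := _root_.saddle_point (a₀ := ch.W s xc) (b₀ := ch.W s xf)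
    (a₁ := ch.W t xc) (b₁ := ch.W t xf) (ch.W_nonneg _ _) (ch.W_nonneg _ _) (ch.W_nonneg _ _)
    (ch.W_nonneg _ _) (fun y h => ⟨hac y h, hz y h t⟩) fun α hα hα1 => by
      obtain ⟨u, hu⟩ := ch.exists_segment hconv s t hα.le hα1.le
      have hu0 : ∀ y, ch.W u xf y = 0 → ch.W u xc y = 0 := fun y hy => by
        have h1 := mul_nonneg hα.le (ch.W_nonneg t xf y)
        have h2 := ch.W_nonneg s xf y
        rw [hu] at hy
        have h3 : ch.W s xf y = 0 := by nlinarith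
        exact (hz y h3 u).1
      have h := hs u
      rw [ch.divergence_eq_ofReal_sum _ _ _ hac, ch.divergence_eq_ofReal_sum _ _ _ hu0,
        ENNReal.ofReal_le_ofReal_iff (Finset.sum_nonneg fun y _ =>
          klTerm_nonneg (ch.W_nonneg _ _ _) (ch.W_nonneg _ _ _) (hu0 y))] at h
      simpa only [hu] using h
  refine ⟨key.1, ?_⟩
  rw [ch.divergence_eq_ofReal_sum _ _ _ hac, ENNReal.toReal_ofReal hnn, ← ch.sum_W t xf,
    ← Finset.sum_add_distrib]
  exact key.2

end CompoundChannel

/-! ### Row metrics with values -∞, and the decoder -/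

lemma EReal.sum_eq_bot_of_eq_bot {ι : Type*} {s : Finset ι} {b : ι → EReal} {i : ι} (hi : i ∈ s)
    (h : b i = ⊥) : ∑ j ∈ s, b j = ⊥ := by
  classical
  rw [← Finset.add_sum_erase _ _ hi, h, EReal.bot_add]

lemma EReal.sum_eq_coe_sum_toReal {ι : Type*} {s : Finset ι} {a : ι → EReal}
    (h : ∀ i ∈ s, a i ≠ ⊥) (h' : ∀ i ∈ s, a i ≠ ⊤) :
    ∑ i ∈ s, a i = ((∑ i ∈ s, (a i).toReal : ℝ) : EReal) := by
  classical
  induction s using Finset.induction_on with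
  | empty => simp
  | insert i s hi ih =>
    rw [Finset.sum_insert hi, Finset.sum_insert hi, EReal.coe_add,
      ih (fun j hj => h j (Finset.mem_insert_of_mem hj))
        (fun j hj => h' j (Finset.mem_insert_of_mem hj)),
      EReal.coe_toReal (h' i (Finset.mem_insert_self _ _)) (h i (Finset.mem_insert_self _ _))]

/-- A finite row can only be matched or beaten by a finite row, so the comparison passes to real
sums; `a` plays the sent row and `b` its rival. -/
lemma sum_toReal_le_of_rowMetric_le {Y : Type*} {g : Y → EReal} (hg : ∀ y, g y ≠ ⊤) {k : ℕ}
    (hk : 0 < k) {a b : Fin k → Y} (ha : ∀ i, g (a i) ≠ ⊥)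
    (h : rowMetric g a ≤ rowMetric g b) :
    (∀ i, g (b i) ≠ ⊥) ∧ ∑ i, (g (a i)).toReal ≤ ∑ i, (g (b i)).toReal := by
  have hk0 : (0 : EReal) < (k : EReal) := by exact_mod_cast hk
  have hkt : (k : EReal) ≠ ⊤ := EReal.natCast_ne_top k
  have h1 : ∑ i, g (a i) ≤ ∑ i, g (b i) :=
    (EReal.strictMono_div_right_of_pos hk0 hkt).le_iff_le.1 h
  rw [EReal.sum_eq_coe_sum_toReal (fun i _ => ha i) (fun i _ => hg _)] at h1
  have hb : ∀ i, g (b i) ≠ ⊥ := fun i hi => by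
    rw [EReal.sum_eq_bot_of_eq_bot (Finset.mem_univ i) hi] at h1
    exact absurd (EReal.bot_lt_coe _) (not_lt.2 h1)
  rw [EReal.sum_eq_coe_sum_toReal (fun i _ => hb i) (fun i _ => hg _)] at h1
  exact ⟨hb, EReal.coe_le_coe_iff.1 h1⟩

lemma exists_rowMetric_le_of_dec_ne {X Y : Type*} (xf xc : X) (g : Y → EReal) {M k : ℕ}
    (y : Fin (M * k) → Y) (m : Fin M)
    (h : (orthogonalCode xf xc g M k).dec y ≠ some m) :
    ∃ m', m' ≠ m ∧ rowMetric g (fun i : Fin k => y (finProdFinEquiv (m, i))) ≤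
      rowMetric g (fun i : Fin k => y (finProdFinEquiv (m', i))) := by
  contrapose! h
  have hex : ∃ m : Fin M, ∀ m' : Fin M, m' ≠ m →
      rowMetric g (fun i : Fin k => y (finProdFinEquiv (m', i))) <
        rowMetric g (fun i : Fin k => y (finProdFinEquiv (m, i))) := ⟨m, h⟩
  have : hex.choose = m := by
    by_contra hne
    exact lt_asymm (hex.choose_spec m (Ne.symm hne)) (h _ hne)
  simp only [orthogonalCode]
  rw [dif_pos hex, this]

/-! ### Error probability of orthogonal codes and achievable rates -/

namespace CompoundChannel

variable {X Y S : Type*}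

lemma orthogonalScheme_subset {xf xc : X} (h : xc ≠ xf) (g : Y → ℝ) :
    orthogonalScheme xf xc (fun y => (g y : EReal)) ⊆ orthogonalCodes X Y xf :=
  fun _ hC => ⟨xc, h, g, hC⟩

lemma cost_pos (ch : CompoundChannel X Y S) {xf : X} (hzero : ∀ x, ch.cost x = 0 ↔ x = xf)
    {xc : X} (h : xc ≠ xf) : 0 < ch.cost xc :=
  (ch.cost_nonneg xc).lt_of_ne fun e => h ((hzero xc).1 e.symm)

/-- The probability of the output block `y` when `m` is sent with an orthogonal code. -/
def blockProb (ch : CompoundChannel X Y S) (s : S) (xf xc : X) {M k : ℕ} (m : Fin M)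
    (y : Fin (M * k) → Y) : ℝ :=
  ∏ i, ch.W s (if (finProdFinEquiv.symm i).1 = m then xc else xf) (y i)

lemma blockProb_nonneg (ch : CompoundChannel X Y S) (s : S) (xf xc : X) {M k : ℕ} (m : Fin M)
    (y : Fin (M * k) → Y) : 0 ≤ ch.blockProb s xf xc m y :=
  Finset.prod_nonneg fun _ _ => ch.W_nonneg _ _ _

lemma sum_cost_orthogonalCode (ch : CompoundChannel X Y S) {xf : X} (hxf : ch.cost xf = 0)
    (xc : X) (g : Y → EReal) (M k : ℕ) (m : Fin M) :
    ∑ i : Fin (M * k), ch.cost ((orthogonalCode xf xc g M k).enc m i) = k * ch.cost xc := by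
  rw [← finProdFinEquiv.sum_comp, Fintype.sum_prod_type, Finset.sum_eq_single m]
  · simp [orthogonalCode]
  · intro a _ ha
    simp [orthogonalCode, ha, hxf]
  · simp

variable [Fintype Y]

/-- Expectation of a product of functions of the entries of one row. -/
lemma sum_blockProb_mul_prod (ch : CompoundChannel X Y S) (s : S) (xf xc : X) {M k : ℕ}
    (m m' : Fin M) (h : Fin k → Y → ℝ) :
    ∑ y : Fin (M * k) → Y, ch.blockProb s xf xc m y * ∏ i, h i (y (finProdFinEquiv (m', i))) =
      ∏ i, ∑ b, ch.W s (if m' = m then xc else xf) b * h i b := by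
  classical
  have h1 : ∀ y : Fin (M * k) → Y, ∏ i, h i (y (finProdFinEquiv (m', i))) =
      ∏ i, if (finProdFinEquiv.symm i).1 = m' then h (finProdFinEquiv.symm i).2 (y i) else 1 := by
    intro y
    rw [← finProdFinEquiv.prod_comp, Fintype.prod_prod_type]
    simp only [Equiv.symm_apply_apply]
    rw [Finset.prod_eq_single m']
    · simp
    · intro a _ ha
      simp [ha]
    · simp
  simp_rw [h1, blockProb, ← Finset.prod_mul_distrib]
  rw [← Fintype.prod_sum (fun (i : Fin (M * k)) (b : Y) =>
    ch.W s (if (finProdFinEquiv.symm i).1 = m then xc else xf) b *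
      if (finProdFinEquiv.symm i).1 = m' then h (finProdFinEquiv.symm i).2 b else 1),
    ← finProdFinEquiv.prod_comp, Fintype.prod_prod_type]
  simp only [Equiv.symm_apply_apply]
  rw [Finset.prod_eq_single m']
  · simp
  · intro a _ ha
    simp [ha, ch.sum_W]
  · simp

lemma sum_blockProb_mul_prod_const (ch : CompoundChannel X Y S) (s : S) (xf xc : X) {M k : ℕ}
    (m m' : Fin M) (h : Y → ℝ) :
    ∑ y : Fin (M * k) → Y, ch.blockProb s xf xc m y * ∏ i, h (y (finProdFinEquiv (m', i))) =
      (∑ b, ch.W s (if m' = m then xc else xf) b * h b) ^ k := by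
  simpa using ch.sum_blockProb_mul_prod s xf xc m m' fun _ => h

lemma sum_blockProb (ch : CompoundChannel X Y S) (s : S) (xf xc : X) {M k : ℕ} (m : Fin M) :
    ∑ y : Fin (M * k) → Y, ch.blockProb s xf xc m y = 1 := by
  have := ch.sum_blockProb_mul_prod s xf xc (k := k) m m (fun _ _ => 1)
  simpa [ch.sum_W] using this

open Classical in
lemma errorProb_orthogonalCode (ch : CompoundChannel X Y S) (s : S) (xf xc : X) (g : Y → EReal)
    (M k : ℕ) : ch.errorProb s (orthogonalCode xf xc g M k) =
      (1 / (M : ℝ)) * ∑ m : Fin M, ∑ y : Fin (M * k) → Y,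
        if (orthogonalCode xf xc g M k).dec y = some m then 0 else ch.blockProb s xf xc m y := by
  unfold errorProb blockProb
  refine congrArg₂ _ rfl (Finset.sum_congr rfl fun m _ => ?_)
  refine Finset.sum_congr rfl fun y _ => ?_
  congr

/-- On an error, either the sent row has sum at most `kτ`, or some rival exceeds `kτ`. The summands
are Chernoff bounds with parameters `l` and 1. The threshold belongs to the analysis only, so it may
depend on the unknown state. Outputs with metric -∞ contribute 0 to the rival bound. -/
lemma errorProb_orthogonalCode_le (ch : CompoundChannel X Y S) (s : S) (xf xc : X)
    (g : Y → EReal) (hg : ∀ y, g y ≠ ⊤) (hgc : ∀ y, ch.W s xc y ≠ 0 → g y ≠ ⊥)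
    {M k : ℕ} (hM : 0 < M) (hk : 0 < k) (τ : ℝ) {l : ℝ} (hl : 0 ≤ l) :
    ch.errorProb s (orthogonalCode xf xc g M k) ≤
      (∑ b, ch.W s xc b * Real.exp (-(l * ((g b).toReal - τ)))) ^ k +
        (M - 1) * (∑ b, ch.W s xf b * (Real.exp (-τ) * (EReal.exp (g b)).toReal)) ^ k := by
  classical
  have hpoint : ∀ (m : Fin M) (y : Fin (M * k) → Y),
      (if (orthogonalCode xf xc g M k).dec y = some m then 0 else ch.blockProb s xf xc m y) ≤
        ch.blockProb s xf xc m y *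
            ∏ i, Real.exp (-(l * ((g (y (finProdFinEquiv (m, i)))).toReal - τ))) +
          ∑ m' ∈ Finset.univ.erase m, ch.blockProb s xf xc m y *
            ∏ i, (Real.exp (-τ) * (EReal.exp (g (y (finProdFinEquiv (m', i))))).toReal) := by
    intro m y
    have hw := ch.blockProb_nonneg s xf xc m y
    have hA : 0 ≤ ∏ i, Real.exp (-(l * ((g (y (finProdFinEquiv (m, i)))).toReal - τ))) :=
      Finset.prod_nonneg fun _ _ => (Real.exp_pos _).le
    have hB : ∀ m' : Fin M,
        0 ≤ ∏ i, (Real.exp (-τ) * (EReal.exp (g (y (finProdFinEquiv (m', i))))).toReal) :=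
      fun m' => Finset.prod_nonneg fun _ _ => mul_nonneg (Real.exp_pos _).le ENNReal.toReal_nonneg
    have hsum : 0 ≤ ∑ m' ∈ Finset.univ.erase m, ch.blockProb s xf xc m y *
        ∏ i, (Real.exp (-τ) * (EReal.exp (g (y (finProdFinEquiv (m', i))))).toReal) :=
      Finset.sum_nonneg fun m' _ => mul_nonneg hw (hB m')
    split_ifs with hdec
    · exact add_nonneg (mul_nonneg hw hA) hsum
    · by_cases hw0 : ch.blockProb s xf xc m y = 0
      · simp [hw0]
      · obtain ⟨m', hm', hle⟩ := exists_rowMetric_le_of_dec_ne xf xc g y m hdec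
        have hrow : ∀ i, g (y (finProdFinEquiv (m, i))) ≠ ⊥ := fun i => by
          have := Finset.prod_ne_zero_iff.1 hw0 (finProdFinEquiv (m, i)) (Finset.mem_univ _)
          simp only [Equiv.symm_apply_apply, if_true] at this
          exact hgc _ this
        obtain ⟨hrow', hle⟩ := sum_toReal_le_of_rowMetric_le hg hk hrow hle
        by_cases hτ : ∑ i, (g (y (finProdFinEquiv (m, i)))).toReal ≤ k * τ
        · refine le_add_of_le_of_nonneg (le_mul_of_one_le_right hw ?_) hsum
          rw [← Real.exp_sum, Real.one_le_exp_iff, Finset.sum_neg_distrib, ← Finset.mul_sum,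
            Finset.sum_sub_distrib]
          simp only [Finset.sum_const, Finset.card_univ, Fintype.card_fin, nsmul_eq_mul]
          have := mul_nonneg hl (sub_nonneg.2 hτ)
          nlinarith
        · refine le_add_of_nonneg_of_le (mul_nonneg hw hA)
            (le_trans (le_mul_of_one_le_right hw ?_) (Finset.single_le_sum
              (f := fun m' => ch.blockProb s xf xc m y * ∏ i, (Real.exp (-τ) *
                (EReal.exp (g (y (finProdFinEquiv (m', i))))).toReal))
              (fun j _ => mul_nonneg hw (hB j))
              (Finset.mem_erase.2 ⟨hm', Finset.mem_univ m'⟩)))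
          have : ∀ i, Real.exp (-τ) * (EReal.exp (g (y (finProdFinEquiv (m', i))))).toReal =
              Real.exp ((g (y (finProdFinEquiv (m', i)))).toReal - τ) := fun i => by
            conv_lhs => rw [← EReal.coe_toReal (hg _) (hrow' i), EReal.exp_coe,
              ENNReal.toReal_ofReal (Real.exp_pos _).le, ← Real.exp_add]
            congr 1
            ring
          simp_rw [this]
          rw [← Real.exp_sum, Real.one_le_exp_iff, Finset.sum_sub_distrib]
          simp only [Finset.sum_const, Finset.card_univ, Fintype.card_fin, nsmul_eq_mul]
          linarith [not_le.1 hτ]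
  have hM' : (0 : ℝ) < M := Nat.cast_pos.2 hM
  rw [errorProb_orthogonalCode, one_div, inv_mul_le_iff₀ hM']
  refine (Finset.sum_le_sum fun m _ => Finset.sum_le_sum fun y _ => hpoint m y).trans_eq ?_
  have hm : ∀ m : Fin M, ∑ y : Fin (M * k) → Y, (ch.blockProb s xf xc m y *
            ∏ i, Real.exp (-(l * ((g (y (finProdFinEquiv (m, i)))).toReal - τ))) +
          ∑ m' ∈ Finset.univ.erase m, ch.blockProb s xf xc m y *
            ∏ i, (Real.exp (-τ) * (EReal.exp (g (y (finProdFinEquiv (m', i))))).toReal)) =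
      (∑ b, ch.W s xc b * Real.exp (-(l * ((g b).toReal - τ)))) ^ k +
        (M - 1) * (∑ b, ch.W s xf b * (Real.exp (-τ) * (EReal.exp (g b)).toReal)) ^ k := by
    intro m
    rw [Finset.sum_add_distrib, Finset.sum_comm,
      ch.sum_blockProb_mul_prod_const s xf xc m m fun b => Real.exp (-(l * ((g b).toReal - τ))),
      if_pos rfl]
    congr 1
    rw [Finset.sum_congr rfl fun m' hm' => (ch.sum_blockProb_mul_prod_const s xf xc m m'
      fun b => Real.exp (-τ) * (EReal.exp (g b)).toReal).trans
        (by rw [if_neg (Finset.ne_of_mem_erase hm')]),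
      Finset.sum_const, Finset.card_erase_of_mem (Finset.mem_univ m), Finset.card_univ,
      Fintype.card_fin, nsmul_eq_mul, Nat.cast_pred hM]
  rw [Finset.sum_congr rfl fun m _ => hm m, Finset.sum_const, Finset.card_univ,
    Fintype.card_fin, nsmul_eq_mul]

/-- An exponential bound on the lower deviations, uniform over all distributions `w`. -/
lemma exists_exp_moment_le (h : Y → ℝ) {δ : ℝ} (hδ : 0 < δ) (hδ1 : δ ≤ 1) :
    ∃ l q : ℝ, 0 ≤ l ∧ 0 ≤ q ∧ q < 1 ∧ ∀ w : Y → ℝ, (∀ y, 0 ≤ w y) → ∑ y, w y = 1 →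
      ∑ y, w y * Real.exp (-(l * (h y - (∑ z, w z * h z - δ)))) ≤ q := by
  set G := ∑ y, |h y| with hG
  have hG0 : 0 ≤ G := Finset.sum_nonneg fun _ _ => abs_nonneg _
  have hhG : ∀ y, |h y| ≤ G := fun y =>
    Finset.single_le_sum (f := fun y => |h y|) (fun _ _ => abs_nonneg _) (Finset.mem_univ y)
  set K := 2 * G + 1 with hK
  have hK1 : 1 ≤ K := by linarith
  have hK0 : 0 < K := by linarith
  -- `K` bounds the centred variable because `δ ≤ 1`. This `l` makes the quadratic error l²K² in exp
  -- x ≤ 1 + x + x² equal to half of the linear gain `lδ`. None of the constants involves `w`.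
  set l := δ / (2 * K ^ 2) with hl
  have hl0 : 0 < l := by positivity
  have hlK : l * K ≤ 1 := by
    rw [hl, div_mul_eq_mul_div, div_le_one (by positivity)]
    nlinarith
  have hlK2 : l * K ^ 2 = δ / 2 := by
    rw [hl]
    field_simp
  have hlδ : l * δ ≤ 1 := by nlinarith
  refine ⟨l, 1 - l * δ / 2, hl0.le, by linarith, by nlinarith, fun w hw hw1 => ?_⟩
  set μ := ∑ z, w z * h z with hμ
  have hμG : |μ| ≤ G := by
    calc |μ| ≤ ∑ z, |w z * h z| := Finset.abs_sum_le_sum_abs _ _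
      _ ≤ ∑ z, w z * G := Finset.sum_le_sum fun z _ => by
          rw [abs_mul, abs_of_nonneg (hw z)]
          exact mul_le_mul_of_nonneg_left (hhG z) (hw z)
      _ = G := by rw [← Finset.sum_mul, hw1, one_mul]
  have hbound : ∀ y, Real.exp (-(l * (h y - (μ - δ)))) ≤
      1 - l * (h y - (μ - δ)) + l * δ / 2 := by
    intro y
    have h1 : |h y - (μ - δ)| ≤ K := by
      have := abs_le.1 (hhG y)
      have := abs_le.1 hμG
      rw [abs_le]
      constructor <;> linarith
    have h2 : |-(l * (h y - (μ - δ)))| ≤ 1 := by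
      rw [abs_neg, abs_mul, abs_of_pos hl0]
      exact (mul_le_mul_of_nonneg_left h1 hl0.le).trans hlK
    have h3 := (abs_le.1 (Real.abs_exp_sub_one_sub_id_le h2)).2
    have h4 : (h y - (μ - δ)) ^ 2 ≤ K ^ 2 := sq_le_sq' (abs_le.1 h1).1 (abs_le.1 h1).2
    have h5 : l ^ 2 * (h y - (μ - δ)) ^ 2 ≤ l ^ 2 * K ^ 2 :=
      mul_le_mul_of_nonneg_left h4 (sq_nonneg l)
    have h6 : l ^ 2 * K ^ 2 = l * δ / 2 := by rw [sq l, mul_assoc, hlK2]; ring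
    nlinarith
  calc ∑ y, w y * Real.exp (-(l * (h y - (μ - δ))))
      ≤ ∑ y, w y * (1 - l * (h y - (μ - δ)) + l * δ / 2) :=
        Finset.sum_le_sum fun y _ => mul_le_mul_of_nonneg_left (hbound y) (hw y)
    _ = ∑ y, (w y * (1 + l * (μ - δ) + l * δ / 2) - l * (w y * h y)) :=
        Finset.sum_congr rfl fun y _ => by ring
    _ = 1 - l * δ / 2 := by
        rw [Finset.sum_sub_distrib, ← Finset.sum_mul, ← Finset.mul_sum, hw1, ← hμ]
        ring

lemma exists_errorProb_le (ch : CompoundChannel X Y S) (xf xc : X)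
    (g : Y → EReal) (hg : ∀ y, g y ≠ ⊤) (hgc : ∀ t y, ch.W t xc y ≠ 0 → g y ≠ ⊥) {r : ℝ}
    (hr : ∀ t, r ≤ ∑ y, (ch.W t xc y * (g y).toReal -
      ch.W t xf y * (EReal.exp (g y)).toReal) + 1) {δ : ℝ} (hδ : 0 < δ) (hδ1 : δ ≤ 1) :
    ∃ q : ℝ, 0 ≤ q ∧ q < 1 ∧ ∀ M k : ℕ, 0 < M → 0 < k → ∀ s,
      ch.errorProb s (orthogonalCode xf xc g M k) ≤
        q ^ k + (M - 1) * Real.exp (-(k * (r - δ))) := by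
  obtain ⟨l, q, hl, hq0, hq1, hlq⟩ := exists_exp_moment_le (fun y => (g y).toReal) hδ hδ1
  refine ⟨q, hq0, hq1, fun M k hM hk s => ?_⟩
  set μ := ∑ z, ch.W s xc z * (g z).toReal with hμ
  refine (ch.errorProb_orthogonalCode_le s xf xc g hg (hgc s) hM hk (μ - δ) hl).trans ?_
  have hM1 : (0 : ℝ) ≤ M - 1 := by
    have : (1 : ℝ) ≤ M := by exact_mod_cast hM
    linarith
  refine add_le_add (pow_le_pow_left₀ (Finset.sum_nonneg fun b _ =>
    mul_nonneg (ch.W_nonneg _ _ _) (Real.exp_pos _).le)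
    (hlq _ (ch.W_nonneg s xc) (ch.sum_W s xc)) k) (mul_le_mul_of_nonneg_left ?_ hM1)
  rw [← mul_neg, Real.exp_nat_mul]
  refine pow_le_pow_left₀ (Finset.sum_nonneg fun b _ => mul_nonneg (ch.W_nonneg _ _ _)
    (mul_nonneg (Real.exp_pos _).le ENNReal.toReal_nonneg)) ?_ k
  set a := ∑ y, ch.W s xf y * (EReal.exp (g y)).toReal with ha
  have h1 : ∑ b, ch.W s xf b * (Real.exp (-(μ - δ)) * (EReal.exp (g b)).toReal) =
      Real.exp (-(μ - δ)) * a := by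
    rw [ha, Finset.mul_sum]
    exact Finset.sum_congr rfl fun b _ => by ring
  -- Replacing log a by a - 1 brings the exponent into the form μ - a + 1, which `hr` bounds below
  -- by `r`.
  have h2 : a ≤ Real.exp (a - 1) := by
    have := Real.add_one_le_exp (a - 1)
    linarith
  have h3 := hr s
  rw [Finset.sum_sub_distrib, ← hμ, ← ha] at h3
  rw [h1]
  calc Real.exp (-(μ - δ)) * a ≤ Real.exp (-(μ - δ)) * Real.exp (a - 1) :=
        mul_le_mul_of_nonneg_left h2 (Real.exp_pos _).le
    _ = Real.exp (-(μ - δ) + (a - 1)) := (Real.exp_add _ _).symm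
    _ ≤ Real.exp (-(r - δ)) := Real.exp_le_exp.2 (by linarith)

lemma isARPUC_orthogonalScheme (ch : CompoundChannel X Y S) {xf xc : X} (hxf : ch.cost xf = 0)
    (hxc : 0 < ch.cost xc) (g : Y → EReal) (hg : ∀ y, g y ≠ ⊤)
    (hgc : ∀ t y, ch.W t xc y ≠ 0 → g y ≠ ⊥) {r : ℝ} (hr0 : 0 ≤ r)
    (hr : ∀ t, r ≤ ∑ y, (ch.W t xc y * (g y).toReal -
      ch.W t xf y * (EReal.exp (g y)).toReal) + 1) :
    ch.IsARPUC (orthogonalScheme xf xc g) (r / ch.cost xc) := by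
  refine ⟨div_nonneg hr0 hxc.le, fun ε hε _ γ hγ => ?_⟩
  set c := ch.cost xc with hc
  -- The budget `γc ≥ 4δ` per symbol covers the `2δ` given up in the choice of `M` and the rounding
  -- of `ν/c` down to `k`; the term `r/δ` in the cost threshold makes that rounding loss at most
  -- `uδ`.
  set δ := min 1 (γ * c / 4) with hδdef
  have hδ : 0 < δ := lt_min one_pos (by positivity)
  have hδγ : 4 * δ ≤ γ * c := by
    have : δ ≤ γ * c / 4 := min_le_right _ _
    linarith
  obtain ⟨q, hq0, hq1, herr⟩ := ch.exists_errorProb_le xf xc g hg hgc hr hδ (min_le_left _ _)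
  have hlim : Tendsto (fun k : ℕ => q ^ k + Real.exp (-δ) ^ k) atTop (𝓝 (0 + 0)) :=
    (tendsto_pow_atTop_nhds_zero_of_lt_one hq0 hq1).add
      (tendsto_pow_atTop_nhds_zero_of_lt_one (Real.exp_pos _).le
        (Real.exp_lt_one_iff.2 (by linarith)))
  rw [add_zero] at hlim
  obtain ⟨N, hN⟩ := eventually_atTop.1 (hlim.eventually_le_const hε)
  refine ⟨c * (N + 1 + r / δ), by positivity, fun ν hν => ?_⟩
  set u := ν / c with hu
  have huν : ν = u * c := by rw [hu, div_mul_cancel₀ _ hxc.ne']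
  have hu1 : N + 1 + r / δ ≤ u := by
    rw [hu, le_div_iff₀ hxc]
    linarith
  have hrδ : 0 ≤ r / δ := by positivity
  have hN0 : (0 : ℝ) ≤ N := Nat.cast_nonneg N
  have hu0 : 0 ≤ u := by linarith
  set k := ⌊u⌋₊ with hk
  have hku : (k : ℝ) ≤ u := Nat.floor_le hu0
  have hku' : u < k + 1 := Nat.lt_floor_add_one u
  have hkN : N + 1 ≤ k := Nat.le_floor (by push_cast; linarith)
  have hk0 : 0 < k := by omega
  set M := ⌈Real.exp (k * (r - 2 * δ))⌉₊ with hMdef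
  have hM : 0 < M := Nat.ceil_pos.2 (Real.exp_pos _)
  refine ⟨orthogonalCode xf xc g M k, ⟨M, k, hk0, rfl⟩, ⟨hM, fun m => ?_, fun s => ?_⟩, ?_⟩
  · refine (ch.sum_cost_orthogonalCode hxf xc g M k m).trans_le ?_
    rw [huν]
    exact mul_le_mul_of_nonneg_right hku hxc.le
  · refine (herr M k hM hk0 s).trans (le_trans ?_ (hN k (by omega)))
    refine add_le_add le_rfl ?_
    have h1 : (M : ℝ) - 1 ≤ Real.exp (k * (r - 2 * δ)) := by
      have := Nat.ceil_lt_add_one (Real.exp_pos (k * (r - 2 * δ))).le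
      linarith
    refine (mul_le_mul_of_nonneg_right h1 (Real.exp_pos _).le).trans_eq ?_
    rw [← Real.exp_add, ← Real.exp_nat_mul]
    congr 1
    ring
  · have h1 : k * (r - 2 * δ) ≤ Real.log M := by
      rw [Real.le_log_iff_exp_le (by exact_mod_cast hM)]
      exact Nat.le_ceil _
    refine lt_of_lt_of_le ?_ h1
    have h2 : ν * (r / c - γ) = u * r - u * (γ * c) := by
      rw [huν]
      field_simp
    have h3 : u * (4 * δ) ≤ u * (γ * c) := mul_le_mul_of_nonneg_left hδγ hu0
    have h4 : r + δ ≤ u * δ := by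
      have : (r / δ + 1) * δ ≤ u * δ := mul_le_mul_of_nonneg_right (by linarith) hδ.le
      have h5 : (r / δ + 1) * δ = r + δ := by field_simp
      linarith
    have h6 : (k : ℝ) * δ ≤ u * δ := mul_le_mul_of_nonneg_right hku hδ.le
    have h7 : (u - 1) * r ≤ k * r := mul_le_mul_of_nonneg_right (by linarith) hr0
    rw [h2]
    nlinarith

end CompoundChannel

/-! ### Converse for orthogonal codes -/

namespace CompoundChannel

variable {X Y S : Type*} [Fintype Y]

lemma sum_blockProb_mul_apply (ch : CompoundChannel X Y S) (s : S) (xf xc : X) {M k : ℕ}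
    (m : Fin M) (j : Fin k) (h : Y → ℝ) :
    ∑ y : Fin (M * k) → Y, ch.blockProb s xf xc m y * h (y (finProdFinEquiv (m, j))) =
      ∑ b, ch.W s xc b * h b := by
  classical
  have := ch.sum_blockProb_mul_prod s xf xc m m fun i b => if i = j then h b else 1
  simp only [Finset.prod_ite_eq', Finset.mem_univ, if_true] at this
  rw [this, Finset.prod_eq_single j]
  · simp
  · intro i _ hi
    simp [hi, ch.sum_W]
  · simp

lemma sum_prod_W (ch : CompoundChannel X Y S) (s : S) (x : X) (n : ℕ) :
    ∑ y : Fin n → Y, ∏ i, ch.W s x (y i) = 1 := by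
  rw [← Fintype.prod_sum (fun (_ : Fin n) (b : Y) => ch.W s x b)]
  simp [ch.sum_W]

/-- The block law and the all-`xf` law differ in row `m` only, so the log-ratio is a sum of `k`
single-letter terms. -/
lemma sum_blockProb_mul_log (ch : CompoundChannel X Y S) (s : S) (xf xc : X)
    (hac : ∀ y, ch.W s xf y = 0 → ch.W s xc y = 0) {M k : ℕ} (m : Fin M) :
    ∑ y : Fin (M * k) → Y, ch.blockProb s xf xc m y *
        Real.log (ch.blockProb s xf xc m y / ∏ i, ch.W s xf (y i)) =
      k * ∑ b, klTerm (ch.W s xc b) (ch.W s xf b) := by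
  have h1 : ∀ y : Fin (M * k) → Y, ch.blockProb s xf xc m y *
        Real.log (ch.blockProb s xf xc m y / ∏ i, ch.W s xf (y i)) =
      ∑ j : Fin k, ch.blockProb s xf xc m y *
        Real.log (ch.W s xc (y (finProdFinEquiv (m, j))) /
          ch.W s xf (y (finProdFinEquiv (m, j)))) := by
    intro y
    rw [← Finset.mul_sum]
    by_cases h0 : ch.blockProb s xf xc m y = 0
    · simp [h0]
    · congr 1
      have hne := Finset.prod_ne_zero_iff.1 h0
      have hne' : ∀ i, ch.W s xf (y i) ≠ 0 := fun i hi => by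
        refine hne i (Finset.mem_univ i) ?_
        split_ifs
        · exact hac _ hi
        · exact hi
      rw [blockProb, ← Finset.prod_div_distrib,
        Real.log_prod fun i hi => div_ne_zero (hne i hi) (hne' i),
        ← finProdFinEquiv.sum_comp, Fintype.sum_prod_type, Finset.sum_eq_single m]
      · simp
      · intro a _ ha
        simp [ha, div_self (hne' _)]
      · simp
  simp_rw [h1]
  rw [Finset.sum_comm]
  simp_rw [ch.sum_blockProb_mul_apply s xf xc m _
    fun b => Real.log (ch.W s xc b / ch.W s xf b)]
  simp [klTerm, Finset.sum_add_distrib, Finset.sum_sub_distrib, ch.sum_W]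

/-- A Fano type converse for orthogonal codes. -/
lemma mul_log_le_of_errorProb_le (ch : CompoundChannel X Y S) (s : S) (xf xc : X)
    (hac : ∀ y, ch.W s xf y = 0 → ch.W s xc y = 0) (g : Y → EReal) {M k : ℕ} (hM : 0 < M)
    {ε : ℝ} (herr : ch.errorProb s (orthogonalCode xf xc g M k) ≤ ε) :
    (1 - ε) * Real.log M ≤ k * ∑ b, klTerm (ch.W s xc b) (ch.W s xf b) + 1 := by
  classical
  have hM1 : (1 : ℝ) ≤ M := by exact_mod_cast hM
  have hM0 : (0 : ℝ) < M := by linarith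
  set D := ∑ b, klTerm (ch.W s xc b) (ch.W s xf b)
  set Q : (Fin (M * k) → Y) → ℝ := fun y => ∏ i, ch.W s xf (y i) with hQ
  set dec := (orthogonalCode xf xc g M k).dec with hdec
  have hQ0 : ∀ y, 0 ≤ Q y := fun y => Finset.prod_nonneg fun _ _ => ch.W_nonneg _ _ _
  have hlogM : 0 ≤ Real.log M := Real.log_nonneg hM1
  -- The test function is `M` where message `m` is decoded and 1 elsewhere.
  have hpoint : ∀ (m : Fin M) (y : Fin (M * k) → Y),
      Real.log M * (ch.blockProb s xf xc m y -
        (if dec y = some m then 0 else ch.blockProb s xf xc m y)) -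
        (M - 1) * (if dec y = some m then Q y else 0) ≤
      klTerm (ch.blockProb s xf xc m y) (Q y) := by
    intro m y
    have hz : Q y = 0 → ch.blockProb s xf xc m y = 0 := fun h => by
      obtain ⟨i, hi, h⟩ := Finset.prod_eq_zero_iff.1 h
      refine Finset.prod_eq_zero hi ?_
      split_ifs
      · exact hac _ h
      · exact h
    split_ifs with h
    · have := le_klTerm (ch.blockProb_nonneg s xf xc m y) (hQ0 y) hM0.le hz
        (fun e => absurd e hM0.ne')
      linarith
    · simpa using klTerm_nonneg (ch.blockProb_nonneg s xf xc m y) (hQ0 y) hz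
  have hmsg : ∀ m : Fin M, Real.log M * (1 - ∑ y : Fin (M * k) → Y,
        if dec y = some m then 0 else ch.blockProb s xf xc m y) -
        (M - 1) * ∑ y : Fin (M * k) → Y, (if dec y = some m then Q y else 0) ≤ k * D := by
    intro m
    have h := Finset.sum_le_sum fun y (_ : y ∈ Finset.univ) => hpoint m y
    rw [Finset.sum_sub_distrib, ← Finset.mul_sum, ← Finset.mul_sum, Finset.sum_sub_distrib,
      ch.sum_blockProb] at h
    refine h.trans_eq ?_
    simp only [klTerm, Finset.sum_add_distrib, Finset.sum_sub_distrib, ch.sum_blockProb]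
    rw [ch.sum_prod_W, ch.sum_blockProb_mul_log s xf xc hac]
    ring
  have hsum := Finset.sum_le_sum fun m (_ : m ∈ Finset.univ) => hmsg m
  rw [Finset.sum_sub_distrib, ← Finset.mul_sum, ← Finset.mul_sum, Finset.sum_sub_distrib] at hsum
  -- Decoding regions are disjoint; this is the only property of the decoder that is needed.
  have hdisj : ∑ m : Fin M, ∑ y : Fin (M * k) → Y, (if dec y = some m then Q y else 0) ≤ 1 := by
    rw [Finset.sum_comm, ← ch.sum_prod_W s xf (M * k)]
    refine Finset.sum_le_sum fun y _ => ?_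
    have h : ∀ o : Option (Fin M), ∑ m : Fin M, (if o = some m then Q y else 0) ≤ Q y := by
      rintro (_ | m₀)
      · simpa using hQ0 y
      · simp
    refine le_trans (le_of_eq (Finset.sum_congr rfl fun _ _ => ?_)) (h (dec y))
    congr
  rw [errorProb_orthogonalCode, one_div, inv_mul_le_iff₀ hM0] at herr
  simp only [Finset.sum_const, Finset.card_univ, Fintype.card_fin, nsmul_eq_mul, mul_one] at hsum
  have h1 := mul_le_mul_of_nonneg_left herr hlogM
  have h2 := mul_le_mul_of_nonneg_left hdisj (sub_nonneg.2 hM1)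
  have h3 : (M : ℝ) * ((1 - ε) * Real.log M) ≤ M * (k * D + 1) := by
    nlinarith
  exact le_of_mul_le_mul_left h3 hM0

/-! ### Matching the two bounds -/

lemma IsARPUC.mono {ch : CompoundChannel X Y S} {K K' : Set (BlockCode X Y)} (h : K ⊆ K') {R : ℝ}
    (hR : ch.IsARPUC K R) : ch.IsARPUC K' R := by
  refine ⟨hR.1, fun ε h0 h1 γ hγ => ?_⟩
  obtain ⟨ν₀, hν₀, H⟩ := hR.2 ε h0 h1 γ hγ
  refine ⟨ν₀, hν₀, fun ν hν => ?_⟩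
  obtain ⟨C, hC, hC'⟩ := H ν hν
  exact ⟨C, h hC, hC'⟩

lemma exists_eq_lowerCpuc [Fintype X] [Nonempty S] (ch : CompoundChannel X Y S) (xf : X)
    (hne : ∃ x : X, x ≠ xf) (hcomp : ch.CompactUncertainty) :
    ∃ xc : X, xc ≠ xf ∧ ∃ s : S, ch.IsLeastFavorable xf xc s ∧
      ch.divergence s xc xf / ENNReal.ofReal (ch.cost xc) = ch.lowerCpuc xf := by
  classical
  obtain ⟨x, hx⟩ := hne
  obtain ⟨xc, hxc, hmax⟩ := (Finset.univ.erase xf).exists_max_image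
    (fun xc => ⨅ s : S, ch.divergence s xc xf / ENNReal.ofReal (ch.cost xc))
    ⟨x, Finset.mem_erase.2 ⟨hx, Finset.mem_univ x⟩⟩
  have hxc := Finset.ne_of_mem_erase hxc
  obtain ⟨s, hs⟩ := ch.exists_isLeastFavorable hcomp xf xc
  refine ⟨xc, hxc, s, hs, le_antisymm (hs.le_lowerCpuc hxc) ?_⟩
  rw [← hs.iInf_eq]
  exact iSup₂_le fun x' hx' => hmax x' (Finset.mem_erase.2 ⟨hx', Finset.mem_univ x'⟩)

/-- Below the lower bound, and at zero, a single real transformation achieves the rate. -/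
lemma exists_scheme [Fintype X] [Nonempty S] (ch : CompoundChannel X Y S) (xf : X)
    (hzero : ∀ x, ch.cost x = 0 ↔ x = xf) (hne : ∃ x : X, x ≠ xf)
    (hconv : ch.ConvexUncertainty) (hcomp : ch.CompactUncertainty) {R : ℝ} (hR0 : 0 ≤ R)
    (hR : R = 0 ∨ ENNReal.ofReal R < ch.lowerCpuc xf) :
    ∃ xc : X, xc ≠ xf ∧ ∃ g : Y → ℝ,
      ch.IsARPUC (orthogonalScheme xf xc (fun y => (g y : EReal))) R := by
  obtain ⟨xc, hxc, s, hs, hsC⟩ := ch.exists_eq_lowerCpuc xf hne hcomp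
  have hc := ch.cost_pos hzero hxc
  refine ⟨xc, hxc, ?_⟩
  obtain ⟨g, hg⟩ : ∃ g : Y → ℝ, ∀ t, R * ch.cost xc ≤
      ∑ y, (ch.W t xc y * g y - ch.W t xf y * Real.exp (g y)) + 1 := by
    -- Rate 0 is separate because the bound itself may be 0, leaving no room for a strict
    -- inequality; `g = 0` then satisfies the minimax inequality with equality.
    rcases hR with rfl | hR
    · exact ⟨fun _ => 0, fun t => by simp [ch.sum_W]⟩
    · refine ch.exists_transformation hconv hcomp xf xc (by positivity) fun t => ?_
      rw [ENNReal.ofReal_mul hR0]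
      refine lt_of_lt_of_le ?_ (hs t)
      rw [← hsC] at hR
      exact (ENNReal.lt_div_iff_mul_lt (Or.inl (by simpa using hc))
        (Or.inl ENNReal.ofReal_ne_top)).1 hR
  refine ⟨g, ?_⟩
  have := ch.isARPUC_orthogonalScheme ((hzero xf).2 rfl) hc (fun y => (g y : EReal))
    (fun y => EReal.coe_ne_top _) (fun _ y _ => EReal.coe_ne_bot _)
    (mul_nonneg hR0 hc.le) (fun t => by
      simpa [EReal.exp_coe, ENNReal.toReal_ofReal (Real.exp_pos _).le] using hg t)
  rwa [mul_div_cancel_right₀ _ hc.ne'] at this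

/-- At the endpoint itself no single real `g` is provided, but the class allows `g` to vary with
`γ`: a scheme of rate at least `R - γ/2` leaves a slack of `γ/2`. -/
lemma isARPUC_orthogonalCodes_of_le [Fintype X] [Nonempty S] (ch : CompoundChannel X Y S) (xf : X)
    (hzero : ∀ x, ch.cost x = 0 ↔ x = xf) (hne : ∃ x : X, x ≠ xf)
    (hconv : ch.ConvexUncertainty) (hcomp : ch.CompactUncertainty) {R : ℝ} (hR0 : 0 ≤ R)
    (hR : ENNReal.ofReal R ≤ ch.lowerCpuc xf) : ch.IsARPUC (orthogonalCodes X Y xf) R := by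
  refine ⟨hR0, fun ε hε hε1 γ hγ => ?_⟩
  have hlt : max (R - γ / 2) 0 = 0 ∨
      ENNReal.ofReal (max (R - γ / 2) 0) < ch.lowerCpuc xf := by
    rcases le_or_gt (R - γ / 2) 0 with h | h
    · exact Or.inl (max_eq_right h)
    · refine Or.inr (lt_of_lt_of_le ?_ hR)
      rw [max_eq_left h.le, ENNReal.ofReal_lt_ofReal_iff_of_nonneg h.le]
      linarith
  obtain ⟨xc, hxc, g, hg⟩ := ch.exists_scheme xf hzero hne hconv hcomp (le_max_right _ _) hlt
  obtain ⟨ν₀, hν₀, H⟩ := (hg.mono (orthogonalScheme_subset hxc g)).2 ε hε hε1 (γ / 2) (by linarith)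
  refine ⟨ν₀, hν₀, fun ν hν => ?_⟩
  obtain ⟨C, hC, hC', hlog⟩ := H ν hν
  refine ⟨C, hC, hC', lt_of_le_of_lt (mul_le_mul_of_nonneg_left ?_ (hν₀.trans hν)) hlog⟩
  linarith [le_max_left (R - γ / 2) 0]

lemma le_lowerCpuc_of_isARPUC [Nonempty S] (ch : CompoundChannel X Y S) (xf : X)
    (hzero : ∀ x, ch.cost x = 0 ↔ x = xf) (hcomp : ch.CompactUncertainty) {R : ℝ}
    (hR : ch.IsARPUC (orthogonalCodes X Y xf) R) : ENNReal.ofReal R ≤ ch.lowerCpuc xf := by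
  by_contra hcon
  rw [not_le] at hcon
  have htop : ch.lowerCpuc xf ≠ ⊤ := ne_top_of_lt hcon
  set C := (ch.lowerCpuc xf).toReal with hC
  have hC0 : 0 ≤ C := ENNReal.toReal_nonneg
  have hCR : C < R := by
    rw [← ENNReal.ofReal_toReal htop] at hcon
    exact (ENNReal.ofReal_lt_ofReal_iff_of_nonneg hC0).1 hcon
  have hR0 : 0 < R := by linarith
  -- The error probability and the rate slack each cost at most a quarter of the gap `R - C`. The
  -- remaining half, times `ν ≥ 2/(R - C)`, is at least the additive 1 of the Fano bound.
  set ε := (R - C) / (4 * R) with hε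
  have hεR : ε * R = (R - C) / 4 := by
    rw [hε]
    field_simp
  have hε0 : 0 < ε := div_pos (by linarith) (by linarith)
  have hε1 : ε < 1 := by
    rw [hε, div_lt_one (by linarith)]
    linarith
  obtain ⟨ν₀, hν₀, H⟩ := hR.2 ε hε0 hε1 ((R - C) / 4) (by linarith)
  obtain ⟨_, ⟨xc, hxc, g, M, k, hk, rfl⟩, ⟨hM, hcost, herr⟩, hlog⟩ :=
    H (max ν₀ (2 / (R - C))) (le_max_left _ _)
  set ν := max ν₀ (2 / (R - C)) with hν
  have hν2 : 2 ≤ ν * (R - C) := by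
    rw [← div_le_iff₀ (by linarith)]
    exact le_max_right _ _
  have hν0 : 0 ≤ ν := hν₀.trans (le_max_left _ _)
  have hc := ch.cost_pos hzero hxc
  have hkν : k * ch.cost xc ≤ ν :=
    (ch.sum_cost_orthogonalCode ((hzero xf).2 rfl) xc _ M k ⟨0, hM⟩).symm.trans_le (hcost _)
  obtain ⟨s, hs⟩ := ch.exists_isLeastFavorable hcomp xf xc
  have hle := hs.le_lowerCpuc hxc
  have hofc : ENNReal.ofReal (ch.cost xc) ≠ 0 := by simpa using hc
  rw [ENNReal.div_le_iff_le_mul (Or.inl hofc) (Or.inl ENNReal.ofReal_ne_top)] at hle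
  have hfin : ch.divergence s xc xf ≠ ⊤ :=
    ne_top_of_le_ne_top (ENNReal.mul_ne_top htop ENNReal.ofReal_ne_top) hle
  have hac := ch.absolutelyContinuous_of_divergence_ne_top hfin
  have hD : ∑ b, klTerm (ch.W s xc b) (ch.W s xf b) ≤ C * ch.cost xc := by
    rw [ch.divergence_eq_ofReal_sum _ _ _ hac, ← ENNReal.ofReal_toReal htop,
      ← ENNReal.ofReal_mul hC0, ENNReal.ofReal_le_ofReal_iff (mul_nonneg hC0 hc.le)] at hle
    exact hle
  have hconv := ch.mul_log_le_of_errorProb_le s xf xc hac _ hM (herr s)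
  have h1 : k * ∑ b, klTerm (ch.W s xc b) (ch.W s xf b) ≤ ν * C := by
    have h2 := mul_le_mul_of_nonneg_left hD (Nat.cast_nonneg (α := ℝ) k)
    have h3 := mul_le_mul_of_nonneg_right hkν hC0
    linarith
  have h4 : (1 - ε) * (ν * (R - (R - C) / 4)) < (1 - ε) * Real.log M :=
    mul_lt_mul_of_pos_left hlog (by linarith)
  have h5 : (1 - ε) * (ν * (R - (R - C) / 4)) =
      ν * (R - (R - C) / 4 - ε * R + ε * ((R - C) / 4)) := by ring
  rw [hεR] at h5
  have h6 : 0 ≤ ν * (ε * ((R - C) / 4)) :=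
    mul_nonneg hν0 (mul_nonneg hε0.le (by linarith))
  nlinarith

/-- The saddle point is applied without smoothing. Its support statement says that no state lets
`xc` produce an output of metric -∞, so the sent row has a finite metric almost surely. -/
lemma isARPUC_logLikelihoodRatio (ch : CompoundChannel X Y S) (xf : X)
    (hzero : ∀ x, ch.cost x = 0 ↔ x = xf) (hconv : ch.ConvexUncertainty) {xc : X} (hxc : xc ≠ xf)
    {s : S} (hs : ch.IsLeastFavorable xf xc s) (hfin : ch.divergence s xc xf ≠ ⊤)
    (hdef : ∀ y : Y, ch.W s xc y = 0 → ch.W s xf y = 0 →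
      ∀ t : S, ch.W t xc y = 0 ∧ ch.W t xf y = 0) :
    ch.IsARPUC (orthogonalScheme xf xc (ch.logLikelihoodRatio xf xc s))
      ((ch.divergence s xc xf).toReal / ch.cost xc) := by
  have hac := ch.absolutelyContinuous_of_divergence_ne_top hfin
  have hsad := hs.saddle_point hconv hfin hdef
  have hexp : ∀ y, (EReal.exp (ch.logLikelihoodRatio xf xc s y)).toReal =
      ch.W s xc y / ch.W s xf y := fun y => by
    rw [logLikelihoodRatio, ENNReal.exp_log, ENNReal.toReal_div]
    rfl
  have hbot : ∀ y, ch.logLikelihoodRatio xf xc s y = ⊥ ↔ ch.W s xc y = 0 := fun y => by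
    rw [logLikelihoodRatio, ENNReal.log_eq_bot_iff, ENNReal.div_eq_zero_iff, W_eq_zero_iff]
    simp [PMF.apply_ne_top]
  have htop : ∀ y, ch.logLikelihoodRatio xf xc s y ≠ ⊤ := fun y h => by
    rw [logLikelihoodRatio, ENNReal.log_eq_top_iff, ENNReal.div_eq_top] at h
    rcases h with ⟨h1, h2⟩ | ⟨h1, -⟩
    · exact h1 ((ch.W_eq_zero_iff _ _ _).1 (hac y ((ch.W_eq_zero_iff _ _ _).2 h2)))
    · exact PMF.apply_ne_top _ _ h1
  have hreal : ∀ y, ch.W s xc y ≠ 0 → (ch.logLikelihoodRatio xf xc s y).toReal =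
      Real.log (ch.W s xc y / ch.W s xf y) := fun y hy => by
    have h1 := EReal.coe_toReal (htop y) fun h => hy ((hbot y).1 h)
    rw [← hexp, ← h1, EReal.exp_coe, EReal.toReal_coe,
      ENNReal.toReal_ofReal (Real.exp_pos _).le, Real.log_exp]
  refine ch.isARPUC_orthogonalScheme ((hzero xf).2 rfl) (ch.cost_pos hzero hxc) _ htop
    (fun t y hy h => hy ((hsad t).1 y ((hbot y).1 h))) ENNReal.toReal_nonneg fun t => ?_
  refine (hsad t).2.trans_eq (congrArg (· + 1) (Finset.sum_congr rfl fun y _ => ?_))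
  rw [hexp]
  by_cases hy : ch.W s xc y = 0
  · simp [(hsad t).1 y hy]
  · rw [hreal y hy]

end CompoundChannel

end

theorem proposition6 {X Y S : Type*} [Fintype X] [Fintype Y] [Nonempty S]
    (ch : CompoundChannel X Y S) (xf : X)
    (hzero : ∀ x, ch.cost x = 0 ↔ x = xf)
    (hne : ∃ x : X, x ≠ xf)
    (hconv : ch.ConvexUncertainty)
    (hcomp : ch.CompactUncertainty) :
    -- the minima over the states and the outer supremum are attained
    (∀ xc : X, xc ≠ xf → ∃ s : S, ch.IsLeastFavorable xf xc s) ∧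
    (∃ xc : X, xc ≠ xf ∧ ∃ s : S, ch.IsLeastFavorable xf xc s ∧
      ch.divergence s xc xf / ENNReal.ofReal (ch.cost xc) = ch.lowerCpuc xf) ∧
    -- the maximum rate per unit cost achievable by orthogonal codes
    (∀ R : ℝ, 0 ≤ R →
      (ch.IsARPUC (orthogonalCodes X Y xf) R ↔ ENNReal.ofReal R ≤ ch.lowerCpuc xf)) ∧
    -- the supremum over fixed symbols and fixed transformations is the same
    IsLUB {ρ : ℝ≥0∞ | ∃ xc : X, xc ≠ xf ∧ ∃ g : Y → ℝ, ∃ R : ℝ,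
        ch.IsARPUC (orthogonalScheme xf xc (fun y => (g y : EReal))) R ∧ ρ = ENNReal.ofReal R}
      (ch.lowerCpuc xf) ∧
    -- it is a lower bound to the capacity per unit cost
    ch.lowerCpuc xf ≤ ch.cpuc ∧
    -- log-likelihood-ratio processing at a least favorable state attains the minimum
    (∀ xc : X, xc ≠ xf → ∀ s : S, ch.IsLeastFavorable xf xc s →
      ch.divergence s xc xf ≠ ⊤ →
      (∀ y : Y, ch.W s xc y = 0 → ch.W s xf y = 0 →
        ∀ t : S, ch.W t xc y = 0 ∧ ch.W t xf y = 0) →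
      ch.IsARPUC (orthogonalScheme xf xc (ch.logLikelihoodRatio xf xc s))
        ((ch.divergence s xc xf).toReal / ch.cost xc)) := by
  have hle : ∀ R : ℝ, 0 ≤ R → ENNReal.ofReal R ≤ ch.lowerCpuc xf →
      ch.IsARPUC (orthogonalCodes X Y xf) R := fun R hR0 hR =>
    ch.isARPUC_orthogonalCodes_of_le xf hzero hne hconv hcomp hR0 hR
  refine ⟨fun xc _ => ch.exists_isLeastFavorable hcomp xf xc,
    ch.exists_eq_lowerCpuc xf hne hcomp,
    fun R hR0 => ⟨ch.le_lowerCpuc_of_isARPUC xf hzero hcomp, hle R hR0⟩, ⟨?_, ?_⟩, ?_,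
    fun xc hxc s hs hfin hdef =>
      ch.isARPUC_logLikelihoodRatio xf hzero hconv hxc hs hfin hdef⟩
  · rintro _ ⟨xc, hxc, g, R, hR, rfl⟩
    exact ch.le_lowerCpuc_of_isARPUC xf hzero hcomp
      (hR.mono (CompoundChannel.orthogonalScheme_subset hxc g))
  · intro b hb
    -- Interpolating a finite value strictly below the bound covers both an infinite bound and one
    -- not attained by a fixed `g`.
    refine le_of_forall_lt fun ρ hρ => ?_
    obtain ⟨ρ', h1, h2⟩ := exists_between hρ
    have hρ' : ENNReal.ofReal ρ'.toReal = ρ' := ENNReal.ofReal_toReal (ne_top_of_lt h2)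
    obtain ⟨xc, hxc, g, hg⟩ := ch.exists_scheme xf hzero hne hconv hcomp
      (R := ρ'.toReal) ENNReal.toReal_nonneg (Or.inr (hρ'.symm ▸ h2))
    exact h1.trans_le (hb ⟨xc, hxc, g, _, hg, hρ'.symm⟩)
  · refine le_of_forall_lt fun ρ hρ => ?_
    obtain ⟨ρ', h1, h2⟩ := exists_between hρ
    have hρ' : ENNReal.ofReal ρ'.toReal = ρ' := ENNReal.ofReal_toReal (ne_top_of_lt h2)
    refine h1.trans_le (hρ'.symm.trans_le ?_)
    exact le_iSup₂ (f := fun (R : ℝ) (_ : ch.IsARPUC Set.univ R) => ENNReal.ofReal R) ρ'.toReal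
      ((hle _ ENNReal.toReal_nonneg (hρ'.trans_le h2.le)).mono (Set.subset_univ _))
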